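/- **Setting.** Let $n,m\ge 1$, let $C\in\mathbb{R}^{n\times n}$ be symmetric, $V\in\mathbb{R}^{m\times m}$ symmetric positive semidefinite and nonzero, and $\Psi\in\mathbb{R}^{m\times n}$ with $\Psi^\top\Psi=\mathbf I_n$. Let $\beta\in(0,+\infty]$, with $\beta^{-1}=0$ if $\beta=+\infty$. Put $v_{ij,kl}=\sum_{p,q=1}^m\Psi_{pi}\Psi_{pj}V_{pq}\Psi_{qk}\Psi_{ql}$ and, for $0\preceq X\preceq\mathbf I_n$, $$\tilde E(X)=\tfrac12\sum_{ijkl}X_{ij}v_{ij,kl}X_{kl},\qquad [\nabla\tilde E(X)]_{ij}=\sum_{kl}v_{ij,kl}X_{kl},$$ $$S_{\mathrm{FD}}(X)=\mathrm{Tr}[X\log X]+\mathrm{Tr}[(\mathbf I_n-X)\log(\mathbf I_n-X)],\qquad F_\beta(X)=\mathrm{Tr}[CX]+\tilde E(X)+\beta^{-1}S_{\mathrm{FD}}(X).$$ Let $\|C\|$ be the spectral norm of $C$, and let $c_{\mathrm h}=\big(\max_p\sum_i|\Psi_{pi}|^2\big)\big(\max_p\sum_q|V_{pq}|\big)$. Let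 $0<N<n$ be real, let $\gamma=N/n\in(0,1)$ be the filling factor, and let $$p^\star=\min\{F_\beta(X):\ 0\preceq X\preceq \mathbf I_n,\ \mathrm{Tr}[X]=N\}.$$ **Fixed-$\mu$ algorithm.** Given $\mu\in\mathbb R$, an integer $T\ge1$ and $\delta'\in(0,1]$, put $$c_{T,m,\delta'}=2\big(1+4\log(2Tm/\delta')\big),\qquad \eta=\frac{1}{c_{T,m,\delta'}\,c_{\mathrm h}\sqrt T},\qquad s=\frac{\eta}{1+\eta\beta^{-1}}$$ (so $s=\eta\beta/(\eta+\beta)$ if $\beta<\infty$). Let $z_0,\dots,z_{T-1}$ be i.i.d. standard Gaussian vectors in $\mathbb R^n$. Set $X_0=\frac12\mathbf I_n$ and define $X_{t+1}$ by $$\nabla S_{\mathrm{FD}}(X_{t+1})=(1-\beta^{-1}s)\nabla S_{\mathrm{FD}}(X_t)-s\,(G_t-\mu\mathbf I_n),\qquad G_t=C+\nabla\tilde E\big(X_t^{1/2}z_tz_t^\top X_t^{1/2}\big),$$ where $\nabla S_{\mathrm{FD}}(X)=\log(X(\mathbf I_n-X)^{-1})$, with inverse $Y\mapsto(\mathbf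 I_n+e^{-Y})^{-1}$ on symmetric matrices. The output is the mean $\overline X_T=\frac1T\sum_{t=0}^{T-1}X_t$. **Chemical potential search.** Let $K\ge1$ be an integer and let $\mu_0,\dots,\mu_K$ be equispaced with $$\mu_0=\lambda_{\min}(C)-c_{\mathrm h}-\beta^{-1}\log(\gamma^{-1}),\qquad \mu_K=\lambda_{\max}(C)+c_{\mathrm h}+\beta^{-1}\log((1-\gamma)^{-1}).$$ Let $\delta\in(0,1]$. For each $k$ run the fixed-$\mu$ algorithm with $\mu=\mu_k$ and $\delta'=\delta/(K+1)$. (Nothing is assumed about the joint law of the noise used for different $k$.) With its output $\overline X_T^{(k)}$ set $$\hat g_{N,\beta,k}=N\mu_k-\big(\mu_k\mathrm{Tr}[\overline X_T^{(k)}]-F_\beta(\overline X_T^{(k)})\big),\qquad \hat g_{N,\beta}=\max_{k=0,\dots,K}\hat g_{N,\beta,k}.$$ **Proposition.** There is an absolute constant $A>0$ (independent of all the data above) such that in every such situation, with probability at least $1-\delta$, $$\frac{|\hat g_{N,\beta}-p^\star|}{n}\le A\left(\frac{c_{\mathrm h}\log(KTm/\delta)}{\sqrt T}+\Big[\frac1T+\frac1K\Big]\Big[\|C\|+c_{\mathrm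 h}+\beta^{-1}\log\Big(\frac{1}{\gamma(1-\gamma)}\Big)\Big]\right).$$ -/

import Mathlib

open Matrix MeasureTheory ProbabilityTheory
open scoped ENNReal

noncomputable section

namespace HartreeMD

/-! ### The Hartree free energy -/

/-- `β⁻¹` as a real number, with `β⁻¹ = 0` for `β = ∞`. -/
def betaInv (β : ℝ≥0∞) : ℝ := (β⁻¹).toReal

/-- The electron repulsion integrals
`v_{ij,kl} = ∑_{p,q} Ψ_{pi} Ψ_{pj} V_{pq} Ψ_{qk} Ψ_{ql}`. -/
def eri {n m : ℕ} (V : Matrix (Fin m) (Fin m) ℝ) (Ψ : Matrix (Fin m) (Fin n) ℝ)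
    (i j k l : Fin n) : ℝ :=
  ∑ p, ∑ q, Ψ p i * Ψ p j * V p q * Ψ q k * Ψ q l

/-- The Hartree energy `Ẽ(X) = ½ ∑_{ijkl} X_{ij} v_{ij,kl} X_{kl}`. -/
def hartreeEnergy {n m : ℕ} (V : Matrix (Fin m) (Fin m) ℝ) (Ψ : Matrix (Fin m) (Fin n) ℝ)
    (X : Matrix (Fin n) (Fin n) ℝ) : ℝ :=
  (1 / 2) * ∑ i, ∑ j, ∑ k, ∑ l, X i j * eri V Ψ i j k l * X k l

/-- The gradient of the Hartree energy, `[∇Ẽ(X)]_{ij} = ∑_{kl} v_{ij,kl} X_{kl}`. -/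
def hartreeGrad {n m : ℕ} (V : Matrix (Fin m) (Fin m) ℝ) (Ψ : Matrix (Fin m) (Fin n) ℝ)
    (X : Matrix (Fin n) (Fin n) ℝ) : Matrix (Fin n) (Fin n) ℝ :=
  Matrix.of fun i j => ∑ k, ∑ l, eri V Ψ i j k l * X k l

/-- The energy `E(X) = Tr[C X] + Ẽ(X)`. -/
def energy {n m : ℕ} (C : Matrix (Fin n) (Fin n) ℝ) (V : Matrix (Fin m) (Fin m) ℝ)
    (Ψ : Matrix (Fin m) (Fin n) ℝ) (X : Matrix (Fin n) (Fin n) ℝ) : ℝ :=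
  (C * X).trace + hartreeEnergy V Ψ X

/-- The Fermi-Dirac entropy `Tr[X log X] + Tr[(I - X) log (I - X)]`
(spectral functional calculus of `x ↦ x log x`, with `0 log 0 = 0`). -/
def fermiDirac {n : ℕ} (X : Matrix (Fin n) (Fin n) ℝ) : ℝ :=
  (cfc (fun x : ℝ => x * Real.log x) X).trace
    + (cfc (fun x : ℝ => x * Real.log x) (1 - X)).trace

/-- The free energy `F_β(X) = E(X) + β⁻¹ S_FD(X)`. -/
def freeEnergy {n m : ℕ} (C : Matrix (Fin n) (Fin n) ℝ) (V : Matrix (Fin m) (Fin m) ℝ)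
    (Ψ : Matrix (Fin m) (Fin n) ℝ) (β : ℝ≥0∞) (X : Matrix (Fin n) (Fin n) ℝ) : ℝ :=
  energy C V Ψ X + betaInv β * fermiDirac X

/-- The optimal value `p⋆` of minimizing `F_β(X)` subject to `0 ⪯ X ⪯ I` and `Tr X = N`. -/
def optValue {n m : ℕ} (C : Matrix (Fin n) (Fin n) ℝ) (V : Matrix (Fin m) (Fin m) ℝ)
    (Ψ : Matrix (Fin m) (Fin n) ℝ) (β : ℝ≥0∞) (N : ℝ) : ℝ :=
  sInf (freeEnergy C V Ψ β ''
    {X : Matrix (Fin n) (Fin n) ℝ | X.PosSemidef ∧ (1 - X).PosSemidef ∧ X.trace = N})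

/-! ### The quantities in the error bound -/

/-- The spectral norm of a matrix (operator norm on Euclidean space). -/
def specNorm {n : ℕ} (A : Matrix (Fin n) (Fin n) ℝ) : ℝ :=
  ‖Matrix.toEuclideanCLM (n := Fin n) (𝕜 := ℝ) A‖

/-- `c_h = c_Ψ ‖V‖_∞`, where `c_Ψ = max_p ∑_i |Ψ_{pi}|²` and `‖V‖_∞ = max_p ∑_q |V_{pq}|`. -/
def cHartree {n m : ℕ} (V : Matrix (Fin m) (Fin m) ℝ) (Ψ : Matrix (Fin m) (Fin n) ℝ) : ℝ :=
  (⨆ p, ∑ i, |Ψ p i| ^ 2) * (⨆ p, ∑ q, |V p q|)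

/-- The smallest eigenvalue of a symmetric matrix. -/
def eigMin {n : ℕ} (C : Matrix (Fin n) (Fin n) ℝ) : ℝ := sInf (spectrum ℝ C)

/-- The largest eigenvalue of a symmetric matrix. -/
def eigMax {n : ℕ} (C : Matrix (Fin n) (Fin n) ℝ) : ℝ := sSup (spectrum ℝ C)

/-! ### Stochastic mirror descent at fixed chemical potential -/

/-- The mirror map `∇S_FD(X) = log (X (I - X)⁻¹)`. -/
def mirrorMap {n : ℕ} (X : Matrix (Fin n) (Fin n) ℝ) : Matrix (Fin n) (Fin n) ℝ :=
  cfc (fun x : ℝ => Real.log (x * (1 - x)⁻¹)) X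

/-- The inverse mirror map `∇S_FD^*(Y) = (I + e^{-Y})⁻¹`. -/
def invMirrorMap {n : ℕ} (Y : Matrix (Fin n) (Fin n) ℝ) : Matrix (Fin n) (Fin n) ℝ :=
  cfc (fun y : ℝ => (1 + Real.exp (-y))⁻¹) Y

/-- The single-shot gradient estimator
`G = C + ∇Ẽ(X̂)` with `X̂ = (X^{1/2} z) (X^{1/2} z)ᵀ`. -/
def gradEst {n m : ℕ} (C : Matrix (Fin n) (Fin n) ℝ) (V : Matrix (Fin m) (Fin m) ℝ)
    (Ψ : Matrix (Fin m) (Fin n) ℝ) (X : Matrix (Fin n) (Fin n) ℝ) (z : Fin n → ℝ) :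
    Matrix (Fin n) (Fin n) ℝ :=
  C + hartreeGrad V Ψ (vecMulVec (cfc Real.sqrt X *ᵥ z) (cfc Real.sqrt X *ᵥ z))

/-- The iterates `X_0 = I / 2`,
`∇S_FD(X_{t+1}) = (1 - β⁻¹ s) ∇S_FD(X_t) - s (G_t - μ I)`, with constant step size `s`
and the noise vector `z t` used in step `t`. -/
def iterate {n m : ℕ} (C : Matrix (Fin n) (Fin n) ℝ) (V : Matrix (Fin m) (Fin m) ℝ)
    (Ψ : Matrix (Fin m) (Fin n) ℝ) (β : ℝ≥0∞) (μ s : ℝ) (z : ℕ → Fin n → ℝ) :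
    ℕ → Matrix (Fin n) (Fin n) ℝ
  | 0 => (1 / 2 : ℝ) • 1
  | t + 1 =>
      invMirrorMap ((1 - betaInv β * s) • mirrorMap (iterate C V Ψ β μ s z t)
        - s • (gradEst C V Ψ (iterate C V Ψ β μ s z t) (z t) - μ • 1))

/-- The Cesàro mean of the iterates `X_0, …, X_{T-1}`. -/
def cesaro {n m : ℕ} (C : Matrix (Fin n) (Fin n) ℝ) (V : Matrix (Fin m) (Fin m) ℝ)
    (Ψ : Matrix (Fin m) (Fin n) ℝ) (β : ℝ≥0∞) (μ s : ℝ) (T : ℕ) (z : ℕ → Fin n → ℝ) :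
    Matrix (Fin n) (Fin n) ℝ :=
  (1 / (T : ℝ)) • ∑ t ∈ Finset.range T, iterate C V Ψ β μ s z t

/-- The proximal step size `η = 1 / (c_{T,m,δ} c_h √T)`, `c_{T,m,δ} = 2 (1 + 4 log (2 T m / δ))`,
for failure probability `δ`. -/
def proxStep {n m : ℕ} (V : Matrix (Fin m) (Fin m) ℝ) (Ψ : Matrix (Fin m) (Fin n) ℝ)
    (T : ℕ) (δ : ℝ) : ℝ :=
  1 / (2 * (1 + 4 * Real.log (2 * T * m / δ)) * cHartree V Ψ * √(T : ℝ))

/-- The mirror descent step size `η β / (η + β)`, written as `η / (1 + η β⁻¹)` so that it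
equals `η` for `β = ∞`. -/
def mirrorStep {n m : ℕ} (V : Matrix (Fin m) (Fin m) ℝ) (Ψ : Matrix (Fin m) (Fin n) ℝ)
    (β : ℝ≥0∞) (T : ℕ) (δ : ℝ) : ℝ :=
  proxStep V Ψ T δ / (1 + proxStep V Ψ T δ * betaInv β)

/-! ### The chemical potential grid -/

/-- Left end of the a priori interval, `λ_min(C) - c_h - β⁻¹ log(1/γ)`, `γ = N / n`. -/
def muLeft {n m : ℕ} (C : Matrix (Fin n) (Fin n) ℝ) (V : Matrix (Fin m) (Fin m) ℝ)
    (Ψ : Matrix (Fin m) (Fin n) ℝ) (β : ℝ≥0∞) (N : ℝ) : ℝ :=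
  eigMin C - cHartree V Ψ - betaInv β * Real.log ((N / n)⁻¹)

/-- Right end of the a priori interval, `λ_max(C) + c_h + β⁻¹ log(1/(1-γ))`, `γ = N / n`. -/
def muRight {n m : ℕ} (C : Matrix (Fin n) (Fin n) ℝ) (V : Matrix (Fin m) (Fin m) ℝ)
    (Ψ : Matrix (Fin m) (Fin n) ℝ) (β : ℝ≥0∞) (N : ℝ) : ℝ :=
  eigMax C + cHartree V Ψ + betaInv β * Real.log ((1 - N / n)⁻¹)

/-- The equispaced grid points `μ_0, …, μ_K`. -/
def muGrid {n m : ℕ} (C : Matrix (Fin n) (Fin n) ℝ) (V : Matrix (Fin m) (Fin m) ℝ)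
    (Ψ : Matrix (Fin m) (Fin n) ℝ) (β : ℝ≥0∞) (N : ℝ) (K : ℕ) (k : Fin (K + 1)) : ℝ :=
  muLeft C V Ψ β N + ((k : ℕ) : ℝ) / K * (muRight C V Ψ β N - muLeft C V Ψ β N)

/-- The estimated dual value `N μ_k - (μ_k Tr[X̄] - F_β(X̄))`, where `X̄` is the Cesàro mean of
`T` iterations at `μ = μ_k`, run with the step size for failure probability `δ / (K + 1)`. -/
def dualEst {n m : ℕ} (C : Matrix (Fin n) (Fin n) ℝ) (V : Matrix (Fin m) (Fin m) ℝ)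
    (Ψ : Matrix (Fin m) (Fin n) ℝ) (β : ℝ≥0∞) (N : ℝ) (K T : ℕ) (δ : ℝ) (k : Fin (K + 1))
    (z : ℕ → Fin n → ℝ) : ℝ :=
  let μ := muGrid C V Ψ β N K k
  let X := cesaro C V Ψ β μ (mirrorStep V Ψ β T (δ / (K + 1))) T z
  N * μ - (μ * X.trace - freeEnergy C V Ψ β X)

/-- The output of the procedure: the largest estimated dual value over the grid. The run at the
`k`-th grid point uses the noise vectors `z k 0, z k 1, …`. -/
def maxDualEst {n m : ℕ} (C : Matrix (Fin n) (Fin n) ℝ) (V : Matrix (Fin m) (Fin m) ℝ)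
    (Ψ : Matrix (Fin m) (Fin n) ℝ) (β : ℝ≥0∞) (N : ℝ) (K T : ℕ) (δ : ℝ)
    (z : Fin (K + 1) → ℕ → Fin n → ℝ) : ℝ :=
  ⨆ k : Fin (K + 1), dualEst C V Ψ β N K T δ k (z k)

end HartreeMD

end

open HartreeMD

open HartreeMD

/-! ### Scalar inequalities -/

/-! The proof is Lagrangian duality in the trace constraint combined with a regret bound for
stochastic mirror descent. For X̄ the mean of the run at μ_k, the estimate is F(X̄) - μ_k (Tr X̄ -
N) (`dualEst_eq`), a value of the Lagrangian at a point of 0 ⪯ X ⪯ I.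

Lower bound on the estimate, deterministic (`optValue_sub_le_maxDualEst`): there is an optimal
multiplier ν in the a priori interval (`exists_chemicalPotential`). At a grid point within one mesh
width of ν, every point of the constraint set has Lagrangian at least p⋆ - |μ_k - ν| n, so the
quality of the run plays no role.

Upper bound, with high probability (`dualEst_sub_le`): every run is compared with one fixed
near-minimizer X of trace N. Its multiplier term vanishes, so the regret bound gives p⋆ plus an
error for all k, and a union bound over the K + 1 runs suffices.

The regret bound (`mirror_descent_regret`, `freeEnergy_cesaro_le`) treats the update as a proximal
step of size η in which the entropy term of F is handled implicitly. The entropy is strongly convex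
in Frobenius norm (`two_mul_trace_sq_le_bregman`), which pays for replacing X_{t+1} by X_t in the
random Hartree part. The constant part C - μI and the entropy are telescoped instead, so ‖C‖ and |μ|
enter only with a factor 1/T.

Two random quantities remain. The squared amplitudes (Ψ X_t^{1/2} z_t)_p² control the size of the
random gradient and have chi-square tails (`measure_amplitude_gt_le`). The accumulated inner product
of the gradient error with X_t - X is a sum of conditionally centred terms; its exponential moment
is bounded one step at a time (`lintegral_exp_gradNoise_le`, `lintegral_prod_stateSeq_le`). -/

theorem convexOn_neg_binEntropy_sub_sq :
    ConvexOn ℝ (Set.Icc 0 1) fun x : ℝ => -Real.binEntropy x - 2 * x ^ 2 := by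
  have hd : ∀ x ∈ Set.Ioo (0 : ℝ) 1, HasDerivAt (fun x : ℝ => -Real.binEntropy x - 2 * x ^ 2)
      (Real.log x - Real.log (1 - x) - 4 * x) x := by
    intro x hx
    have := (Real.hasDerivAt_binEntropy hx.1.ne' hx.2.ne).neg.sub
      (((hasDerivAt_id x).pow 2).const_mul 2)
    refine HasDerivAt.congr_deriv this ?_
    simp; ring
  have hd2 : ∀ x ∈ Set.Ioo (0 : ℝ) 1, HasDerivAt (fun x => Real.log x - Real.log (1 - x) - 4 * x)
      (x⁻¹ + (1 - x)⁻¹ - 4) x := by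
    intro x hx
    have h1 := Real.hasDerivAt_log hx.1.ne'
    have h2 := ((hasDerivAt_id x).const_sub 1).log (by simpa using (sub_pos.2 hx.2).ne')
    refine HasDerivAt.congr_deriv ((h1.sub h2).sub ((hasDerivAt_id x).const_mul 4)) ?_
    simp only [id]; field_simp
    ring
  refine convexOn_of_hasDerivWithinAt2_nonneg (f' := fun x => Real.log x - Real.log (1 - x) - 4 * x)
    (f'' := fun x => x⁻¹ + (1 - x)⁻¹ - 4) (convex_Icc 0 1) (by fun_prop) ?_ ?_ ?_ <;>
    rw [interior_Icc]
  · exact fun x hx => (hd x hx).hasDerivWithinAt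
  · exact fun x hx => (hd2 x hx).hasDerivWithinAt
  · intro x hx
    have h1 := hx.1
    have h2 : 0 < 1 - x := sub_pos.2 hx.2
    -- The negative entropy has second derivative 1/(x(1-x)) ≥ 4, with equality at x = 1/2; hence
    -- the sharp coefficient 2 of the square.
    have : x⁻¹ + (1 - x)⁻¹ - 4 = (1 - 2 * x) ^ 2 / (x * (1 - x)) := by
      field_simp; ring
    rw [this]; positivity

theorem convexOn_neg_binEntropy : ConvexOn ℝ (Set.Icc 0 1) fun x : ℝ => -Real.binEntropy x :=
  Real.strictConcave_binEntropy.concaveOn.neg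

/-- Quadratic lower bound on the Bregman divergence of the negative binary entropy. -/
theorem two_mul_sq_le_binEntropy_bregman {x p : ℝ} (hx : x ∈ Set.Icc (0 : ℝ) 1)
    (hp : p ∈ Set.Ioo (0 : ℝ) 1) :
    2 * (x - p) ^ 2 ≤ -Real.binEntropy x - -Real.binEntropy p
      - (Real.log p - Real.log (1 - p)) * (x - p) := by
  have hd : HasDerivAt (fun x : ℝ => -Real.binEntropy x - 2 * x ^ 2)
      (Real.log p - Real.log (1 - p) - 4 * p) p := by
    have := (Real.hasDerivAt_binEntropy hp.1.ne' hp.2.ne).neg.sub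
      (((hasDerivAt_id p).pow 2).const_mul 2)
    refine HasDerivAt.congr_deriv this ?_
    simp; ring
  have hp' : p ∈ Set.Icc (0 : ℝ) 1 := ⟨hp.1.le, hp.2.le⟩
  rcases lt_trichotomy x p with h | rfl | h
  · have := convexOn_neg_binEntropy_sub_sq.slope_le_of_hasDerivAt hx hp' h hd
    rw [slope_def_field, div_le_iff₀ (by linarith)] at this
    linarith
  · simp
  · have := convexOn_neg_binEntropy_sub_sq.le_slope_of_hasDerivAt hp' hx h hd
    rw [slope_def_field, le_div_iff₀ (by linarith)] at this
    linarith

theorem sigmoid_log_sub_log (y : ℝ) :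
    Real.log (1 + Real.exp (-y))⁻¹ - Real.log (1 - (1 + Real.exp (-y))⁻¹) = y := by
  have h : 0 < Real.exp (-y) := Real.exp_pos _
  have h1 : 1 - (1 + Real.exp (-y))⁻¹ = Real.exp (-y) * (1 + Real.exp (-y))⁻¹ := by
    field_simp; ring
  rw [h1, Real.log_mul h.ne' (by positivity), Real.log_exp]; ring

theorem sigmoid_mem_Ioo (y : ℝ) : (1 + Real.exp (-y))⁻¹ ∈ Set.Ioo (0 : ℝ) 1 := by
  have h : 0 < Real.exp (-y) := Real.exp_pos _
  exact ⟨by positivity, inv_lt_one_of_one_lt₀ (by linarith)⟩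

theorem logit_sigmoid (y : ℝ) :
    Real.log ((1 + Real.exp (-y))⁻¹ * (1 - (1 + Real.exp (-y))⁻¹)⁻¹) = y := by
  have h := sigmoid_mem_Ioo y
  rw [Real.log_mul h.1.ne' (inv_ne_zero (sub_pos.2 h.2).ne'), Real.log_inv (1 - _), ← sub_eq_add_neg,
    sigmoid_log_sub_log]

/-- A convex function rises by at most its slope at the new point p times the displacement ε(1-x).
In the slope log p - log(1-p), the first term is nonpositive and is dropped, while log(1-p) splits
as log(1-ε) + log(1-x). The displacement turns log(1-x) into `negMulLog`, so nothing diverges as x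
tends to 1. -/
theorem neg_binEntropy_toward_one {x ε : ℝ} (hx : x ∈ Set.Icc (0 : ℝ) 1)
    (hε : ε ∈ Set.Ioo (0 : ℝ) 1) :
    -Real.binEntropy ((1 - ε) * x + ε) - -Real.binEntropy x ≤
      ε * ((1 - x) * -Real.log (1 - ε) + Real.negMulLog (1 - x)) := by
  obtain ⟨h0, h1⟩ := hε
  rcases hx.2.eq_or_lt with rfl | hx1
  · simp
  have hx1' : 0 < 1 - x := by linarith
  have hp : (1 - ε) * x + ε ∈ Set.Ioo (0 : ℝ) 1 := by
    constructor <;> nlinarith [hx.1]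
  have h := (by positivity : (0 : ℝ) ≤ 2 * (x - ((1 - ε) * x + ε)) ^ 2).trans
    (two_mul_sq_le_binEntropy_bregman hx hp)
  have e1 : 1 - ((1 - ε) * x + ε) = (1 - ε) * (1 - x) := by ring
  have e2 : x - ((1 - ε) * x + ε) = -(ε * (1 - x)) := by ring
  rw [e1, e2, Real.log_mul (by linarith) hx1'.ne'] at h
  have hl : Real.log ((1 - ε) * x + ε) ≤ 0 := Real.log_nonpos hp.1.le hp.2.le
  have := mul_nonneg (mul_nonneg h0.le hx1'.le) (neg_nonneg.2 hl)
  simp only [Real.negMulLog]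
  linarith

theorem neg_binEntropy_toward_zero {x ε : ℝ} (hx : x ∈ Set.Icc (0 : ℝ) 1)
    (hε : ε ∈ Set.Ioo (0 : ℝ) 1) :
    -Real.binEntropy ((1 - ε) * x) - -Real.binEntropy x ≤
      ε * (x * -Real.log (1 - ε) + Real.negMulLog x) := by
  have h := neg_binEntropy_toward_one (x := 1 - x) ⟨by linarith [hx.2], by linarith [hx.1]⟩ hε
  have e : (1 - ε) * (1 - x) + ε = 1 - (1 - ε) * x := by ring
  rw [e, Real.binEntropy_one_sub, Real.binEntropy_one_sub] at h
  simpa using h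

/-- The left side is the logarithm of the mean of exp(θ(1 - g²)) for a standard Gaussian g; the
linear terms cancel and the remainder of log(1-x) at x = -2θ is quadratic. -/
theorem sub_half_log_one_add_le {θ : ℝ} (h : |θ| ≤ 1 / 4) :
    θ - Real.log (1 + 2 * θ) / 2 ≤ 4 * θ ^ 2 := by
  have h2 : |(-(2 * θ))| ≤ 1 / 2 := by rw [abs_neg, abs_mul, abs_two]; linarith
  have := Real.abs_log_sub_add_sum_range_le (x := -(2 * θ)) (by linarith) 1
  have h3 : |(-(2 * θ))| ^ (1 + 1) / (1 - |(-(2 * θ))|) ≤ 8 * θ ^ 2 := by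
    rw [div_le_iff₀ (by linarith), one_add_one_eq_two, sq_abs]
    nlinarith [sq_nonneg θ]
  have h4 := (abs_le.1 (this.trans h3)).1
  simp at h4
  linarith

/-! ### Spectral decompositions of symmetric matrices -/

/-- `A = U diag(a) Uᵀ` with `U` orthogonal, compatibly with the functional calculus. -/
structure IsSpectral {n : ℕ} (A U : Matrix (Fin n) (Fin n) ℝ) (a : Fin n → ℝ) : Prop where
  transpose_mul : Uᵀ * U = 1
  mul_transpose : U * Uᵀ = 1
  cfc_eq : ∀ f : ℝ → ℝ, cfc f A = U * diagonal (fun i => f (a i)) * Uᵀ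
  mem_spectrum : ∀ i, a i ∈ spectrum ℝ A
  isHermitian : A.IsHermitian

theorem Matrix.IsHermitian.exists_isSpectral {n : ℕ} {A : Matrix (Fin n) (Fin n) ℝ}
    (hA : A.IsHermitian) : ∃ U a, IsSpectral A U a := by
  refine ⟨hA.eigenvectorUnitary, hA.eigenvalues, ?_, ?_, fun f => ?_,
    hA.eigenvalues_mem_spectrum_real, hA⟩
  · simpa [star_eq_conjTranspose] using Unitary.coe_star_mul_self hA.eigenvectorUnitary
  · simpa [star_eq_conjTranspose] using Unitary.coe_mul_star_self hA.eigenvectorUnitary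
  · rw [hA.cfc_eq, Matrix.IsHermitian.cfc, Unitary.conjStarAlgAut_apply]
    simp [star_eq_conjTranspose, Function.comp_def]

theorem Matrix.IsHermitian.cfc_id {n : ℕ} {A : Matrix (Fin n) (Fin n) ℝ} (hA : A.IsHermitian) :
    _root_.cfc (id : ℝ → ℝ) A = A :=
  _root_.cfc_id ℝ A hA.isSelfAdjoint

/-- The spectrum is finite, hence discrete. The functional calculus therefore accepts every scalar
function, including those singular at 0 or 1. -/
theorem continuousOn_spectrum {n : ℕ} (A : Matrix (Fin n) (Fin n) ℝ) (f : ℝ → ℝ) :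
    ContinuousOn f (spectrum ℝ A) :=
  A.finite_real_spectrum.continuousOn f

theorem cfc_cfc {n : ℕ} {A : Matrix (Fin n) (Fin n) ℝ} (hA : A.IsHermitian) (g f : ℝ → ℝ) :
    cfc g (cfc f A) = cfc (fun x => g (f x)) A :=
  (cfc_comp' g f A ((A.finite_real_spectrum.image f).continuousOn g)
    (continuousOn_spectrum A f) hA).symm

theorem isHermitian_cfc {n : ℕ} (f : ℝ → ℝ) (A : Matrix (Fin n) (Fin n) ℝ) :
    (cfc f A).IsHermitian :=
  cfc_predicate f A

section
open scoped Matrix.Norms.L2Operator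

theorem continuousOn_cfc_isHermitian {n : ℕ} {f : ℝ → ℝ} (hf : Continuous f) :
    ContinuousOn (fun A : Matrix (Fin n) (Fin n) ℝ => cfc f A) {A | A.IsHermitian} :=
  ContinuousOn.cfc_of_mem_nhdsSet (𝕜 := ℝ) (A := Matrix (Fin n) (Fin n) ℝ)
    (p := IsSelfAdjoint) f (a := id) (t := {A | A.IsHermitian}) (s := Set.univ) Filter.univ_mem continuousOn_id
    (fun _ hx => Matrix.IsHermitian.isSelfAdjoint hx) hf.continuousOn

end

namespace IsSpectral

variable {n : ℕ} {A U : Matrix (Fin n) (Fin n) ℝ} {a : Fin n → ℝ}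

theorem eq (h : IsSpectral A U a) : A = U * diagonal a * Uᵀ := by
  have := h.cfc_eq id
  rwa [h.isHermitian.cfc_id] at this

theorem trace_cfc (h : IsSpectral A U a) (f : ℝ → ℝ) : (cfc f A).trace = ∑ i, f (a i) := by
  rw [h.cfc_eq, trace_mul_comm, ← Matrix.mul_assoc, h.transpose_mul, Matrix.one_mul, trace_diagonal]

theorem trace_eq (h : IsSpectral A U a) : A.trace = ∑ i, a i := by
  have := h.trace_cfc id
  rwa [h.isHermitian.cfc_id] at this

theorem trace_cfc_mul (h : IsSpectral A U a) (f : ℝ → ℝ) (B : Matrix (Fin n) (Fin n) ℝ) :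
    (cfc f A * B).trace = ∑ i, f (a i) * (Uᵀ * B * U) i i := by
  rw [h.cfc_eq, Matrix.mul_assoc, Matrix.mul_assoc, trace_mul_comm, Matrix.mul_assoc,
    Matrix.trace]
  simp [diagonal_mul]

theorem trace_mul (h : IsSpectral A U a) (B : Matrix (Fin n) (Fin n) ℝ) :
    (A * B).trace = ∑ i, a i * (Uᵀ * B * U) i i := by
  have := h.trace_cfc_mul id B
  rwa [h.isHermitian.cfc_id] at this

theorem trace_conj (h : IsSpectral A U a) (B : Matrix (Fin n) (Fin n) ℝ) :
    ∑ i, (Uᵀ * B * U) i i = B.trace := by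
  change (Uᵀ * B * U).trace = _
  rw [trace_mul_comm, ← Matrix.mul_assoc, h.mul_transpose, Matrix.one_mul]

variable {B W : Matrix (Fin n) (Fin n) ℝ} {b : Fin n → ℝ}

theorem conj_cfc_apply (h : IsSpectral B W b) (f : ℝ → ℝ) (U : Matrix (Fin n) (Fin n) ℝ)
    (i : Fin n) :
    (Uᵀ * cfc f B * U) i i = ∑ j, (Uᵀ * W) i j ^ 2 * f (b j) := by
  have e : Uᵀ * cfc f B * U = Uᵀ * W * diagonal (fun j => f (b j)) * (Uᵀ * W)ᵀ := by
    rw [h.cfc_eq, Matrix.transpose_mul, transpose_transpose]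
    simp only [Matrix.mul_assoc]
  rw [e, Matrix.mul_apply]
  simp only [mul_diagonal, transpose_apply]
  exact Finset.sum_congr rfl fun j _ => by ring

theorem conj_apply (h : IsSpectral B W b) (U : Matrix (Fin n) (Fin n) ℝ) (i : Fin n) :
    (Uᵀ * B * U) i i = ∑ j, (Uᵀ * W) i j ^ 2 * b j := by
  have := h.conj_cfc_apply id U i
  rwa [h.isHermitian.cfc_id] at this

theorem sum_overlap (hA : IsSpectral A U a) (hB : IsSpectral B W b) (i : Fin n) :
    ∑ j, (Uᵀ * W) i j ^ 2 = 1 := by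
  have : (Uᵀ * W) * (Uᵀ * W)ᵀ = 1 := by
    rw [Matrix.transpose_mul, transpose_transpose, Matrix.mul_assoc, ← Matrix.mul_assoc W,
      hB.mul_transpose, Matrix.one_mul, hA.transpose_mul]
  have h := congrFun (congrFun this i) i
  rw [Matrix.mul_apply, one_apply_eq] at h
  simpa [pow_two] using h

theorem sum_overlap' (hA : IsSpectral A U a) (hB : IsSpectral B W b) (j : Fin n) :
    ∑ i, (Uᵀ * W) i j ^ 2 = 1 := by
  rw [← hB.sum_overlap hA j]
  refine Finset.sum_congr rfl fun i _ => ?_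
  rw [← transpose_apply (Uᵀ * W), Matrix.transpose_mul, transpose_transpose]

/-- **Peierls inequality.** -/
theorem sum_convex_conj_le (hA : IsSpectral A U a) (hB : IsSpectral B W b) {s : Set ℝ} {f : ℝ → ℝ}
    (hf : ConvexOn ℝ s f) (hs : ∀ j, b j ∈ s) :
    ∑ i, f ((Uᵀ * B * U) i i) ≤ (cfc f B).trace := by
  have key : ∀ i, f ((Uᵀ * B * U) i i) ≤ ∑ j, (Uᵀ * W) i j ^ 2 * f (b j) := by
    intro i
    rw [hB.conj_apply]
    exact hf.map_sum_le (fun j _ => sq_nonneg _) (hA.sum_overlap hB i) fun j _ => hs j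
  refine (Finset.sum_le_sum fun i _ => key i).trans_eq ?_
  rw [Finset.sum_comm, hB.trace_cfc]
  refine Finset.sum_congr rfl fun j _ => ?_
  rw [← Finset.sum_mul, hA.sum_overlap' hB, one_mul]

end IsSpectral

/-- The constraint set `0 ⪯ X ⪯ I`. -/
def occupations (n : ℕ) : Set (Matrix (Fin n) (Fin n) ℝ) :=
  {X | X.PosSemidef ∧ (1 - X).PosSemidef}

theorem convex_occupations (n : ℕ) : Convex ℝ (occupations n) := by
  intro X hX Y hY s t hs ht hst
  refine ⟨(hX.1.smul hs).add (hY.1.smul ht), ?_⟩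
  have : 1 - (s • X + t • Y) = s • (1 - X) + t • (1 - Y) := by
    rw [smul_sub, smul_sub, sub_add_sub_comm, ← add_smul, hst, one_smul]
  rw [this]
  exact (hX.2.smul hs).add (hY.2.smul ht)

theorem Matrix.PosSemidef.conj_apply_nonneg {n : ℕ} {X : Matrix (Fin n) (Fin n) ℝ}
    (hX : X.PosSemidef) {m : ℕ} (U : Matrix (Fin n) (Fin m) ℝ) (i : Fin m) :
    0 ≤ (Uᵀ * X * U) i i := by
  have := (hX.conjTranspose_mul_mul_same U).diag_nonneg (i := i)
  simpa using this

theorem conj_mem_Icc {n m : ℕ} {X : Matrix (Fin n) (Fin n) ℝ} (hX : X ∈ occupations n)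
    (U : Matrix (Fin n) (Fin m) ℝ) (i : Fin m) :
    (Uᵀ * X * U) i i ∈ Set.Icc 0 ((Uᵀ * U) i i) := by
  refine ⟨hX.1.conj_apply_nonneg U i, ?_⟩
  have := hX.2.conj_apply_nonneg U i
  rw [Matrix.mul_sub, Matrix.sub_mul, Matrix.mul_one, Matrix.sub_apply] at this
  linarith

theorem IsSpectral.conj_mem_Icc {n : ℕ} {A U X : Matrix (Fin n) (Fin n) ℝ} {a : Fin n → ℝ}
    (h : IsSpectral A U a) (hX : X ∈ occupations n) (i : Fin n) :
    (Uᵀ * X * U) i i ∈ Set.Icc (0 : ℝ) 1 := by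
  simpa [h.transpose_mul] using _root_.conj_mem_Icc hX U i

theorem IsSpectral.eigenvalue_eq {n : ℕ} {A U : Matrix (Fin n) (Fin n) ℝ} {a : Fin n → ℝ}
    (h : IsSpectral A U a) (i : Fin n) : (Uᵀ * A * U) i i = a i := by
  conv_lhs => rw [h.eq]
  rw [show Uᵀ * (U * diagonal a * Uᵀ) * U = (Uᵀ * U) * diagonal a * (Uᵀ * U) by
    simp only [Matrix.mul_assoc], h.transpose_mul, Matrix.one_mul, Matrix.mul_one, diagonal_apply_eq]

theorem IsSpectral.mem_Icc {n : ℕ} {X U : Matrix (Fin n) (Fin n) ℝ} {x : Fin n → ℝ}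
    (h : IsSpectral X U x) (hX : X ∈ occupations n) (i : Fin n) : x i ∈ Set.Icc (0 : ℝ) 1 :=
  h.eigenvalue_eq i ▸ h.conj_mem_Icc hX i

theorem cfc_mem_occupations {n : ℕ} {A : Matrix (Fin n) (Fin n) ℝ} (hA : A.IsHermitian) {f : ℝ → ℝ}
    (hf : ∀ x, f x ∈ Set.Icc (0 : ℝ) 1) : cfc f A ∈ occupations n := by
  obtain ⟨U, a, h⟩ := hA.exists_isSpectral
  have key : ∀ d : Fin n → ℝ, (∀ i, 0 ≤ d i) → (U * diagonal d * Uᵀ).PosSemidef := by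
    intro d hd
    simpa using (PosSemidef.diagonal (n := Fin n) hd).mul_mul_conjTranspose_same U
  rw [h.cfc_eq]
  refine ⟨key _ fun i => (hf _).1, ?_⟩
  have e : (1 : Matrix (Fin n) (Fin n) ℝ) - U * diagonal (fun i => f (a i)) * Uᵀ
      = U * diagonal (fun i => 1 - f (a i)) * Uᵀ := by
    rw [show diagonal (fun i => 1 - f (a i)) = 1 - diagonal (fun i => f (a i)) by
      rw [← diagonal_one, diagonal_sub], Matrix.mul_sub, Matrix.sub_mul, Matrix.mul_one,
      h.mul_transpose]
  rw [e]
  exact key _ fun i => sub_nonneg.2 (hf _).2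

/-! ### The Fermi-Dirac entropy -/

theorem fermiDirac_eq_trace {n : ℕ} {X : Matrix (Fin n) (Fin n) ℝ} (hX : X.IsHermitian) :
    fermiDirac X = (cfc (fun x => -Real.binEntropy x) X).trace := by
  have h1 : 1 - X = cfc (fun x : ℝ => 1 - x) X := by
    rw [cfc_sub (fun _ => (1 : ℝ)) (fun x => x) X (continuousOn_spectrum _ _)
      (continuousOn_spectrum _ _), cfc_const_one ℝ X hX.isSelfAdjoint, cfc_id' ℝ X hX.isSelfAdjoint]
  obtain ⟨U, x, h⟩ := hX.exists_isSpectral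
  rw [fermiDirac, h1, cfc_cfc hX, h.trace_cfc, h.trace_cfc, h.trace_cfc, ← Finset.sum_add_distrib]
  refine Finset.sum_congr rfl fun i _ => ?_
  simp only [Real.binEntropy, Real.log_inv]
  ring

theorem IsSpectral.fermiDirac_eq {n : ℕ} {X U : Matrix (Fin n) (Fin n) ℝ} {x : Fin n → ℝ}
    (h : IsSpectral X U x) : fermiDirac X = ∑ i, -Real.binEntropy (x i) := by
  rw [fermiDirac_eq_trace h.isHermitian, h.trace_cfc]

theorem IsSpectral.fermiDirac_cfc {n : ℕ} {X U : Matrix (Fin n) (Fin n) ℝ} {x : Fin n → ℝ}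
    (h : IsSpectral X U x) (f : ℝ → ℝ) :
    fermiDirac (cfc f X) = ∑ i, -Real.binEntropy (f (x i)) := by
  rw [fermiDirac_eq_trace (isHermitian_cfc f X), cfc_cfc h.isHermitian, h.trace_cfc]

/-- In the eigenbasis of the convex combination Z, its eigenvalues are the same combination of the
diagonals of X and Y. Scalar convexity applies entrywise, and Peierls' inequality replaces diagonals
by spectra. -/
theorem convexOn_fermiDirac (n : ℕ) :
    ConvexOn ℝ (occupations n) (fermiDirac : Matrix (Fin n) (Fin n) ℝ → ℝ) := by
  refine ⟨convex_occupations n, fun X hX Y hY s t hs ht hst => ?_⟩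
  have hZ := convex_occupations n hX hY hs ht hst
  obtain ⟨U, z, hU⟩ := hZ.1.isHermitian.exists_isSpectral
  obtain ⟨V, x, hV⟩ := hX.1.isHermitian.exists_isSpectral
  obtain ⟨W, y, hW⟩ := hY.1.isHermitian.exists_isSpectral
  have h1 := hU.sum_convex_conj_le hV convexOn_neg_binEntropy (hV.mem_Icc hX)
  have h2 := hU.sum_convex_conj_le hW convexOn_neg_binEntropy (hW.mem_Icc hY)
  rw [← fermiDirac_eq_trace hV.isHermitian] at h1
  rw [← fermiDirac_eq_trace hW.isHermitian] at h2
  rw [hU.fermiDirac_eq, smul_eq_mul, smul_eq_mul]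
  refine le_trans ?_ (add_le_add (mul_le_mul_of_nonneg_left h1 hs)
    (mul_le_mul_of_nonneg_left h2 ht))
  rw [Finset.mul_sum, Finset.mul_sum, ← Finset.sum_add_distrib]
  refine Finset.sum_le_sum fun i _ => ?_
  have e : z i = s • (Uᵀ * X * U) i i + t • (Uᵀ * Y * U) i i := by
    rw [← hU.eigenvalue_eq i, Matrix.mul_add, Matrix.add_mul, Matrix.add_apply]
    simp
  rw [e]
  exact convexOn_neg_binEntropy.2 (hU.conj_mem_Icc hX i) (hU.conj_mem_Icc hY i) hs ht hst

theorem fermiDirac_nonpos {n : ℕ} {X : Matrix (Fin n) (Fin n) ℝ} (hX : X ∈ occupations n) :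
    fermiDirac X ≤ 0 := by
  obtain ⟨U, x, h⟩ := hX.1.isHermitian.exists_isSpectral
  rw [h.fermiDirac_eq]
  exact Finset.sum_nonpos fun i _ => neg_nonpos.2
    (Real.binEntropy_nonneg (h.mem_Icc hX i).1 (h.mem_Icc hX i).2)

theorem neg_log_two_le_fermiDirac {n : ℕ} {X : Matrix (Fin n) (Fin n) ℝ} (hX : X.IsHermitian) :
    -(n * Real.log 2) ≤ fermiDirac X := by
  obtain ⟨U, x, h⟩ := hX.exists_isSpectral
  rw [h.fermiDirac_eq, Finset.sum_neg_distrib, neg_le_neg_iff]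
  refine (Finset.sum_le_sum fun i _ => Real.binEntropy_le_log_two).trans_eq ?_
  simp

theorem trace_sq_eq {n : ℕ} {X : Matrix (Fin n) (Fin n) ℝ} {U : Matrix (Fin n) (Fin n) ℝ}
    {x : Fin n → ℝ} (h : IsSpectral X U x) : (X * X).trace = ∑ i, x i ^ 2 := by
  rw [h.trace_mul]
  exact Finset.sum_congr rfl fun i _ => by rw [h.eigenvalue_eq]; ring

/-- Strong convexity of the Fermi-Dirac entropy: the Bregman divergence dominates the squared
Frobenius distance. -/
theorem two_mul_trace_sq_le_bregman {n : ℕ} {X Y : Matrix (Fin n) (Fin n) ℝ}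
    (hX : X ∈ occupations n) (hY : Y.IsHermitian) :
    2 * ((X - invMirrorMap Y) * (X - invMirrorMap Y)).trace ≤
      fermiDirac X - fermiDirac (invMirrorMap Y) - (Y * (X - invMirrorMap Y)).trace := by
  obtain ⟨U, x, hU⟩ := hX.1.isHermitian.exists_isSpectral
  obtain ⟨W, y, hW⟩ := hY.exists_isSpectral
  set σ : ℝ → ℝ := fun y => (1 + Real.exp (-y))⁻¹ with hσ
  have hP : invMirrorMap Y = cfc σ Y := rfl
  -- Klein's argument: the squared overlaps of the two eigenbases form a doubly stochastic array, so
  -- each trace is a w-weighted double sum and the inequality reduces to the scalar one for each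
  -- pair of eigenvalues.
  set w : Fin n → Fin n → ℝ := fun i j => (Wᵀ * U) i j ^ 2 with hw
  have row : ∀ (f : ℝ → ℝ), ∑ i, ∑ j, w i j * f (y i) = ∑ i, f (y i) := fun f =>
    Finset.sum_congr rfl fun i _ => by rw [← Finset.sum_mul, hW.sum_overlap hU, one_mul]
  have col : ∀ (f : ℝ → ℝ), ∑ i, ∑ j, w i j * f (x j) = ∑ j, f (x j) := fun f => by
    rw [Finset.sum_comm]
    exact Finset.sum_congr rfl fun j _ => by rw [← Finset.sum_mul, hW.sum_overlap' hU, one_mul]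
  have mix : ∀ f : ℝ → ℝ, (cfc f Y * X).trace = ∑ i, ∑ j, w i j * (f (y i) * x j) := fun f => by
    rw [hW.trace_cfc_mul]
    refine Finset.sum_congr rfl fun i _ => ?_
    rw [hU.conj_apply, Finset.mul_sum]
    exact Finset.sum_congr rfl fun j _ => by simp only [hw]; ring
  have mixid : (Y * X).trace = ∑ i, ∑ j, w i j * (y i * x j) := by
    have := mix id
    rwa [hY.cfc_id] at this
  have hYP : (Y * cfc σ Y).trace = ∑ i, y i * σ (y i) := by
    rw [trace_mul_comm, hW.trace_cfc_mul]
    exact Finset.sum_congr rfl fun i _ => by rw [hW.eigenvalue_eq]; ring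
  have hPP : (cfc σ Y * cfc σ Y).trace = ∑ i, σ (y i) ^ 2 := by
    rw [← cfc_mul σ σ Y (continuousOn_spectrum _ _) (continuousOn_spectrum _ _), hW.trace_cfc]
    exact Finset.sum_congr rfl fun i _ => by ring
  have main : 0 ≤ ∑ i, ∑ j, w i j * (-Real.binEntropy (x j) - -Real.binEntropy (σ (y i))
      - y i * (x j - σ (y i)) - 2 * (x j - σ (y i)) ^ 2) := by
    refine Finset.sum_nonneg fun i _ => Finset.sum_nonneg fun j _ =>
      mul_nonneg (sq_nonneg _) ?_
    have := two_mul_sq_le_binEntropy_bregman (hU.mem_Icc hX j) (sigmoid_mem_Ioo (y i))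
    rw [sigmoid_log_sub_log] at this
    simp only [hσ]; linarith
  have expand : ∑ i, ∑ j, w i j * (-Real.binEntropy (x j) - -Real.binEntropy (σ (y i))
      - y i * (x j - σ (y i)) - 2 * (x j - σ (y i)) ^ 2)
      = ∑ j, -Real.binEntropy (x j) - ∑ i, -Real.binEntropy (σ (y i))
        - ∑ i, ∑ j, w i j * (y i * x j) + ∑ i, y i * σ (y i)
        - 2 * ∑ j, x j ^ 2 + 4 * ∑ i, ∑ j, w i j * (σ (y i) * x j) - 2 * ∑ i, σ (y i) ^ 2 := by
    rw [← col fun t => -Real.binEntropy t, ← row fun t => -Real.binEntropy (σ t),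
      ← row fun t => t * σ t, ← col fun t => t ^ 2, ← row fun t => σ t ^ 2]
    simp only [Finset.mul_sum, ← Finset.sum_add_distrib, ← Finset.sum_sub_distrib]
    exact Finset.sum_congr rfl fun i _ => Finset.sum_congr rfl fun j _ => by ring
  rw [expand, ← mixid, ← mix σ, ← hYP, ← hPP, ← trace_sq_eq hU, ← hU.fermiDirac_eq,
    ← hW.fermiDirac_cfc σ] at main
  rw [hP]
  simp only [Matrix.mul_sub, Matrix.sub_mul, trace_sub]
  rw [trace_mul_comm X (cfc σ Y)]
  linarith

theorem mirrorMap_invMirrorMap {n : ℕ} {Y : Matrix (Fin n) (Fin n) ℝ} (hY : Y.IsHermitian) :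
    mirrorMap (invMirrorMap Y) = Y := by
  rw [mirrorMap, invMirrorMap, cfc_cfc hY]
  simp only [logit_sigmoid]
  exact cfc_id' ℝ Y hY.isSelfAdjoint

theorem invMirrorMap_mem_occupations {n : ℕ} {Y : Matrix (Fin n) (Fin n) ℝ} (hY : Y.IsHermitian) :
    invMirrorMap Y ∈ occupations n :=
  cfc_mem_occupations hY fun y => ⟨(sigmoid_mem_Ioo y).1.le, (sigmoid_mem_Ioo y).2.le⟩

theorem invMirrorMap_zero {n : ℕ} :
    invMirrorMap (0 : Matrix (Fin n) (Fin n) ℝ) = (1 / 2 : ℝ) • 1 := by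
  rw [invMirrorMap, cfc_apply_zero, Algebra.algebraMap_eq_smul_one]
  norm_num

/-! ### The Hartree energy in terms of the density -/

/-- The density `ρ_p = (Ψ X Ψᵀ)_{pp}`. -/
def density {n m : ℕ} (Ψ : Matrix (Fin m) (Fin n) ℝ) (X : Matrix (Fin n) (Fin n) ℝ) :
    Fin m → ℝ := fun p => (Ψ * X * Ψᵀ) p p

/-- `max_p ∑_i |Ψ_{pi}|²`. -/
noncomputable def coherence {n m : ℕ} (Ψ : Matrix (Fin m) (Fin n) ℝ) : ℝ := ⨆ p, ∑ i, |Ψ p i| ^ 2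

/-- `max_p ∑_q |V_{pq}|`. -/
noncomputable def maxRowSum {m : ℕ} (V : Matrix (Fin m) (Fin m) ℝ) : ℝ := ⨆ p, ∑ q, |V p q|

section

variable {n m : ℕ} (C : Matrix (Fin n) (Fin n) ℝ) (V : Matrix (Fin m) (Fin m) ℝ)
  (Ψ : Matrix (Fin m) (Fin n) ℝ)

theorem cHartree_eq : cHartree V Ψ = coherence Ψ * maxRowSum V := rfl

theorem density_apply (X : Matrix (Fin n) (Fin n) ℝ) (p : Fin m) :
    density Ψ X p = ∑ i, ∑ j, Ψ p i * X i j * Ψ p j := by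
  simp only [density, Matrix.mul_apply, transpose_apply, Finset.sum_mul]
  exact Finset.sum_comm

theorem density_add (X Y : Matrix (Fin n) (Fin n) ℝ) :
    density Ψ (X + Y) = density Ψ X + density Ψ Y := by
  ext p; simp [density, Matrix.mul_add, Matrix.add_mul]

theorem density_sub (X Y : Matrix (Fin n) (Fin n) ℝ) :
    density Ψ (X - Y) = density Ψ X - density Ψ Y := by
  ext p; simp [density, Matrix.mul_sub, Matrix.sub_mul]

theorem density_smul (c : ℝ) (X : Matrix (Fin n) (Fin n) ℝ) :
    density Ψ (c • X) = c • density Ψ X := by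
  ext p; simp [density]

theorem density_vecMulVec (v : Fin n → ℝ) (p : Fin m) :
    density Ψ (vecMulVec v v) p = (Ψ *ᵥ v) p ^ 2 := by
  rw [density_apply, pow_two, mulVec, dotProduct, Finset.sum_mul_sum]
  simp only [vecMulVec_apply]
  exact Finset.sum_congr rfl fun i _ => Finset.sum_congr rfl fun j _ => by ring

variable {Ψ} in
theorem sum_density (hΨ : Ψᵀ * Ψ = 1) (X : Matrix (Fin n) (Fin n) ℝ) :
    ∑ p, density Ψ X p = X.trace := by
  change (Ψ * X * Ψᵀ).trace = _
  rw [trace_mul_comm, ← Matrix.mul_assoc, hΨ, Matrix.one_mul]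

theorem sum_sq_le_coherence (p : Fin m) : ∑ i, Ψ p i ^ 2 ≤ coherence Ψ := by
  have := le_ciSup (f := fun p => ∑ i, |Ψ p i| ^ 2) (Set.finite_range _).bddAbove p
  simpa [coherence] using this

theorem sum_abs_le_maxRowSum (p : Fin m) : ∑ q, |V p q| ≤ maxRowSum V :=
  le_ciSup (f := fun p => ∑ q, |V p q|) (Set.finite_range _).bddAbove p

variable {Ψ} in
-- Conjugating 0 ⪯ X ⪯ I by Ψ puts the density between 0 and the diagonal of ΨΨᵀ, whose entries are
-- the squared row norms of Ψ.
theorem density_mem_Icc {X : Matrix (Fin n) (Fin n) ℝ} (hX : X ∈ occupations n) (p : Fin m) :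
    density Ψ X p ∈ Set.Icc 0 (coherence Ψ) := by
  have h := conj_mem_Icc hX Ψᵀ p
  rw [transpose_transpose] at h
  refine ⟨h.1, h.2.trans (le_trans (le_of_eq ?_) (sum_sq_le_coherence Ψ p))⟩
  simp [Matrix.mul_apply, pow_two]

theorem hartreeGrad_eq (X : Matrix (Fin n) (Fin n) ℝ) :
    hartreeGrad V Ψ X = Ψᵀ * diagonal (V *ᵥ density Ψ X) * Ψ := by
  ext i j
  rw [Matrix.mul_apply]
  simp only [hartreeGrad, of_apply, eri, mul_diagonal, transpose_apply, mulVec,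
    dotProduct, density_apply, Finset.sum_mul, Finset.mul_sum]
  calc _ = ∑ k, ∑ p, ∑ l, ∑ q, Ψ p i * Ψ p j * V p q * Ψ q k * Ψ q l * X k l := by
        refine Finset.sum_congr rfl fun k _ => Finset.sum_comm
    _ = ∑ p, ∑ k, ∑ q, ∑ l, Ψ p i * Ψ p j * V p q * Ψ q k * Ψ q l * X k l := by
        rw [Finset.sum_comm]
        exact Finset.sum_congr rfl fun p _ => Finset.sum_congr rfl fun k _ => Finset.sum_comm
    _ = _ := by
        refine Finset.sum_congr rfl fun p _ => ?_
        rw [Finset.sum_comm]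
        exact Finset.sum_congr rfl fun q _ => Finset.sum_congr rfl fun k _ =>
          Finset.sum_congr rfl fun l _ => by ring

theorem trace_hartreeGrad_mul (X Z : Matrix (Fin n) (Fin n) ℝ) :
    (hartreeGrad V Ψ X * Z).trace = (V *ᵥ density Ψ X) ⬝ᵥ density Ψ Z := by
  rw [hartreeGrad_eq, Matrix.mul_assoc, Matrix.mul_assoc, trace_mul_comm, Matrix.mul_assoc,
    Matrix.trace, dotProduct]
  simp [diagonal_mul, density]

theorem isHermitian_hartreeGrad (X : Matrix (Fin n) (Fin n) ℝ) :
    (hartreeGrad V Ψ X).IsHermitian := by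
  rw [hartreeGrad_eq, IsHermitian, conjTranspose_eq_transpose_of_trivial]
  simp [Matrix.transpose_mul, Matrix.mul_assoc]

theorem hartreeEnergy_eq (X : Matrix (Fin n) (Fin n) ℝ) :
    hartreeEnergy V Ψ X = 1 / 2 * ((V *ᵥ density Ψ X) ⬝ᵥ density Ψ X) := by
  -- The trace pairing produces a transpose, and X is not assumed symmetric here; the density sees
  -- only the symmetric part.
  have hT : density Ψ Xᵀ = density Ψ X := by
    ext p
    rw [density_apply, density_apply, Finset.sum_comm]
    exact Finset.sum_congr rfl fun i _ => Finset.sum_congr rfl fun j _ => by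
      rw [transpose_apply]; ring
  nth_rewrite 2 [← hT]
  rw [← trace_hartreeGrad_mul, hartreeEnergy, Matrix.trace]
  simp only [diag_apply, Matrix.mul_apply, hartreeGrad, of_apply, Finset.sum_mul, transpose_apply]
  congr 1
  refine Finset.sum_congr rfl fun i _ => Finset.sum_congr rfl fun j _ =>
    Finset.sum_congr rfl fun k _ => Finset.sum_congr rfl fun l _ => by ring

variable {V}

theorem hartreeEnergy_nonneg (hV : V.PosSemidef) (X : Matrix (Fin n) (Fin n) ℝ) :
    0 ≤ hartreeEnergy V Ψ X := by
  rw [hartreeEnergy_eq, dotProduct_comm]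
  have := hV.dotProduct_mulVec_nonneg (density Ψ X)
  rw [star_trivial] at this
  positivity

/-- For a quadratic form the gap between the two sides is exactly the form at Y - X, which is
nonnegative since V is. -/
theorem hartreeEnergy_tangent (hV : V.PosSemidef) (X Y : Matrix (Fin n) (Fin n) ℝ) :
    (V *ᵥ density Ψ X) ⬝ᵥ density Ψ (Y - X) ≤ hartreeEnergy V Ψ Y - hartreeEnergy V Ψ X := by
  have h := hartreeEnergy_nonneg Ψ hV (Y - X)
  have hs : (V *ᵥ density Ψ X) ⬝ᵥ density Ψ Y = (V *ᵥ density Ψ Y) ⬝ᵥ density Ψ X := by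
    rw [dotProduct_comm, dotProduct_mulVec, ← mulVec_transpose]
    have : Vᵀ = V := by simpa using hV.isHermitian.eq
    rw [this]
  rw [hartreeEnergy_eq, density_sub, mulVec_sub, sub_dotProduct, dotProduct_sub, dotProduct_sub] at h
  rw [hartreeEnergy_eq, hartreeEnergy_eq, density_sub, dotProduct_sub]
  linarith

variable (V)

theorem abs_mulVec_le {r : ℝ} {ρ : Fin m → ℝ} (hρ : ∀ p, |ρ p| ≤ r) (p : Fin m) :
    |(V *ᵥ ρ) p| ≤ r * maxRowSum V := by
  have hr : 0 ≤ r := (abs_nonneg _).trans (hρ p)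
  calc |∑ q, V p q * ρ q| ≤ ∑ q, |V p q * ρ q| := Finset.abs_sum_le_sum_abs _ _
    _ ≤ ∑ q, r * |V p q| := Finset.sum_le_sum fun q _ => by
        rw [abs_mul, mul_comm]; exact mul_le_mul_of_nonneg_right (hρ q) (abs_nonneg _)
    _ ≤ _ := by rw [← Finset.mul_sum]; exact mul_le_mul_of_nonneg_left (sum_abs_le_maxRowSum V p) hr

variable {Ψ} in
theorem abs_density_le {X : Matrix (Fin n) (Fin n) ℝ} (hX : X ∈ occupations n) (p : Fin m) :
    |density Ψ X p| ≤ coherence Ψ := by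
  rw [abs_of_nonneg (density_mem_Icc hX p).1]; exact (density_mem_Icc hX p).2

variable {Ψ} in
theorem abs_mulVec_density_le {X : Matrix (Fin n) (Fin n) ℝ} (hX : X ∈ occupations n) (p : Fin m) :
    |(V *ᵥ density Ψ X) p| ≤ cHartree V Ψ :=
  abs_mulVec_le V (abs_density_le hX) p

variable {Ψ} in
theorem abs_density_sub_le {X Y : Matrix (Fin n) (Fin n) ℝ} (hX : X ∈ occupations n)
    (hY : Y ∈ occupations n) (p : Fin m) : |density Ψ (X - Y) p| ≤ coherence Ψ := by
  rw [density_sub, Pi.sub_apply, abs_le]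
  constructor <;> linarith [(density_mem_Icc (Ψ := Ψ) hX p).1, (density_mem_Icc (Ψ := Ψ) hX p).2,
    (density_mem_Icc (Ψ := Ψ) hY p).1, (density_mem_Icc (Ψ := Ψ) hY p).2]

variable {V Ψ}

theorem coherence_pos (hΨ : Ψᵀ * Ψ = 1) (hn : 0 < n) : 0 < coherence Ψ := by
  by_contra! h
  have h0 : ∀ p i, Ψ p i = 0 := fun p i => by
    have h1 := (sum_sq_le_coherence Ψ p).trans h
    have h2 := Finset.single_le_sum (f := fun i => Ψ p i ^ 2) (fun i _ => sq_nonneg _)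
      (Finset.mem_univ i)
    exact pow_eq_zero_iff two_ne_zero |>.1 (le_antisymm (h2.trans h1) (sq_nonneg _))
  have := congrFun (congrFun hΨ ⟨0, hn⟩) ⟨0, hn⟩
  simp [Matrix.mul_apply, h0] at this

theorem maxRowSum_pos (hV : V ≠ 0) : 0 < maxRowSum V := by
  by_contra! h
  refine hV (ext fun p q => abs_eq_zero.1 (le_antisymm ?_ (abs_nonneg _)))
  exact (Finset.single_le_sum (f := fun q => |V p q|) (fun i _ => abs_nonneg _)
    (Finset.mem_univ q)).trans ((sum_abs_le_maxRowSum V p).trans h)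

theorem cHartree_pos (hΨ : Ψᵀ * Ψ = 1) (hn : 0 < n) (hV : V ≠ 0) : 0 < cHartree V Ψ :=
  mul_pos (coherence_pos hΨ hn) (maxRowSum_pos hV)

/-! ### Linear terms -/

variable {C}

theorem abs_le_specNorm {x : ℝ} (hx : x ∈ spectrum ℝ C) : |x| ≤ specNorm C := by
  have h1 : x ∈ spectrum ℝ (Matrix.toEuclideanCLM (n := Fin n) (𝕜 := ℝ) C) := by
    rwa [AlgEquiv.spectrum_eq]
  have h2 := spectrum.norm_le_norm_mul_of_mem h1
  have h3 : ‖(1 : EuclideanSpace ℝ (Fin n) →L[ℝ] EuclideanSpace ℝ (Fin n))‖ ≤ 1 :=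
    ContinuousLinearMap.norm_id_le
  exact h2.trans (mul_le_of_le_one_right (norm_nonneg _) h3)

theorem IsSpectral.eigMin_le {U : Matrix (Fin n) (Fin n) ℝ} {c : Fin n → ℝ}
    (h : IsSpectral C U c) (i : Fin n) : eigMin C ≤ c i :=
  csInf_le C.finite_real_spectrum.bddBelow (h.mem_spectrum i)

theorem IsSpectral.le_eigMax {U : Matrix (Fin n) (Fin n) ℝ} {c : Fin n → ℝ}
    (h : IsSpectral C U c) (i : Fin n) : c i ≤ eigMax C :=
  le_csSup C.finite_real_spectrum.bddAbove (h.mem_spectrum i)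

theorem eigMin_mul_trace_le (hC : C.IsHermitian) {X : Matrix (Fin n) (Fin n) ℝ}
    (hX : X.PosSemidef) : eigMin C * X.trace ≤ (C * X).trace := by
  obtain ⟨U, c, h⟩ := hC.exists_isSpectral
  rw [h.trace_mul, ← h.trace_conj, Finset.mul_sum]
  exact Finset.sum_le_sum fun i _ =>
    mul_le_mul_of_nonneg_right (h.eigMin_le i) (hX.conj_apply_nonneg U i)

theorem trace_mul_le_eigMax (hC : C.IsHermitian) {X : Matrix (Fin n) (Fin n) ℝ}
    (hX : X.PosSemidef) : (C * X).trace ≤ eigMax C * X.trace := by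
  obtain ⟨U, c, h⟩ := hC.exists_isSpectral
  rw [h.trace_mul, ← h.trace_conj, Finset.mul_sum]
  exact Finset.sum_le_sum fun i _ =>
    mul_le_mul_of_nonneg_right (h.le_eigMax i) (hX.conj_apply_nonneg U i)

/-- In the eigenbasis of C the diagonals of X and Y lie in [0,1], so each of the n eigenvalues is
weighted by a number in [-1,1]. -/
theorem abs_trace_mul_sub_le (hC : C.IsHermitian) {X Y : Matrix (Fin n) (Fin n) ℝ}
    (hX : X ∈ occupations n) (hY : Y ∈ occupations n) :
    |(C * (X - Y)).trace| ≤ n * specNorm C := by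
  obtain ⟨U, c, h⟩ := hC.exists_isSpectral
  rw [h.trace_mul]
  refine (Finset.abs_sum_le_sum_abs _ _).trans ?_
  calc _ ≤ ∑ _i : Fin n, specNorm C := Finset.sum_le_sum fun i _ => by
        have hx := h.conj_mem_Icc hX i
        have hy := h.conj_mem_Icc hY i
        rw [abs_mul, Matrix.mul_sub, Matrix.sub_mul, Matrix.sub_apply]
        refine (mul_le_of_le_one_right (abs_nonneg _) ?_).trans (abs_le_specNorm (h.mem_spectrum i))
        rw [abs_le]; constructor <;> linarith [hx.1, hx.2, hy.1, hy.2]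
    _ = _ := by simp

theorem trace_mem_Icc {X : Matrix (Fin n) (Fin n) ℝ} (hX : X ∈ occupations n) :
    X.trace ∈ Set.Icc (0 : ℝ) n := by
  have h1 := hX.1.trace_nonneg
  have h2 := hX.2.trace_nonneg
  rw [trace_sub, trace_one, Fintype.card_fin] at h2
  exact ⟨h1, by linarith⟩

theorem specNorm_nonneg : 0 ≤ specNorm C := norm_nonneg _

theorem eigMin_eigMax_bounds (hC : C.IsHermitian) (hn : 0 < n) :
    -specNorm C ≤ eigMin C ∧ eigMin C ≤ eigMax C ∧ eigMax C ≤ specNorm C := by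
  have : NeZero n := ⟨hn.ne'⟩
  obtain ⟨U, c, h⟩ := hC.exists_isSpectral
  have hne : (spectrum ℝ C).Nonempty := ⟨_, h.mem_spectrum 0⟩
  exact ⟨le_csInf hne fun x hx => (abs_le.1 (abs_le_specNorm hx)).1,
    (h.eigMin_le 0).trans (h.le_eigMax 0), csSup_le hne fun x hx => (abs_le.1 (abs_le_specNorm hx)).2⟩

/-! ### Convexity of the free energy -/

theorem convexOn_hartreeEnergy (hV : V.PosSemidef) :
    ConvexOn ℝ (occupations n) (hartreeEnergy V Ψ) := by
  refine ⟨convex_occupations n, fun X _ Y _ s t hs ht hst => ?_⟩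
  set Z := s • X + t • Y with hZ
  have h1 := mul_le_mul_of_nonneg_left (hartreeEnergy_tangent Ψ hV Z X) hs
  have h2 := mul_le_mul_of_nonneg_left (hartreeEnergy_tangent Ψ hV Z Y) ht
  have h3 : s * ((V *ᵥ density Ψ Z) ⬝ᵥ density Ψ (X - Z))
      + t * ((V *ᵥ density Ψ Z) ⬝ᵥ density Ψ (Y - Z)) = 0 := by
    rw [← smul_eq_mul, ← smul_eq_mul, ← dotProduct_smul, ← dotProduct_smul, ← dotProduct_add,
      ← density_smul, ← density_smul, ← density_add]
    have : s • (X - Z) + t • (Y - Z) = 0 := by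
      rw [smul_sub, smul_sub, sub_add_sub_comm, ← add_smul, hst, one_smul, hZ, sub_self]
    rw [this, ← zero_smul ℝ (0 : Matrix (Fin n) (Fin n) ℝ), density_smul, zero_smul, dotProduct_zero]
  have h4 : hartreeEnergy V Ψ Z = (s + t) * hartreeEnergy V Ψ Z := by rw [hst, one_mul]
  rw [smul_eq_mul, smul_eq_mul]
  linarith

theorem convexOn_energy (hV : V.PosSemidef) : ConvexOn ℝ (occupations n) (energy C V Ψ) := by
  refine ConvexOn.add ⟨convex_occupations n, fun X _ Y _ s t _ _ _ => ?_⟩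
    (convexOn_hartreeEnergy hV)
  simp [Matrix.mul_add]

theorem betaInv_nonneg (β : ℝ≥0∞) : 0 ≤ betaInv β := ENNReal.toReal_nonneg

theorem convexOn_freeEnergy (hV : V.PosSemidef) (β : ℝ≥0∞) :
    ConvexOn ℝ (occupations n) (freeEnergy C V Ψ β) :=
  (convexOn_energy hV).add ((convexOn_fermiDirac n).smul (betaInv_nonneg β))

theorem freeEnergy_lower_bound (hC : C.IsHermitian) (hV : V.PosSemidef) (β : ℝ≥0∞)
    {X : Matrix (Fin n) (Fin n) ℝ} (hX : X ∈ occupations n) :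
    -(n * specNorm C) - betaInv β * (n * Real.log 2) ≤ freeEnergy C V Ψ β X := by
  have h0 : (0 : Matrix (Fin n) (Fin n) ℝ) ∈ occupations n :=
    ⟨PosSemidef.zero, by rw [sub_zero]; exact PosSemidef.one⟩
  have h1 := (abs_le.1 (abs_trace_mul_sub_le hC hX h0)).1
  rw [sub_zero] at h1
  have h2 := hartreeEnergy_nonneg Ψ hV X
  have h3 := mul_le_mul_of_nonneg_left (neg_log_two_le_fermiDirac hX.1.isHermitian)
    (betaInv_nonneg β)
  rw [freeEnergy, energy]
  linarith

end

/-! ### The chemical potential -/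

section

variable {n m : ℕ} {C : Matrix (Fin n) (Fin n) ℝ} {V : Matrix (Fin m) (Fin m) ℝ}
  {Ψ : Matrix (Fin m) (Fin n) ℝ} {β : ℝ≥0∞} {N : ℝ}

/-- Without a lower bound, the real `sInf` defining `optValue` would be a default value. -/
theorem bddBelow_freeEnergy (hC : C.IsHermitian) (hV : V.PosSemidef) :
    BddBelow (freeEnergy C V Ψ β ''
      {X : Matrix (Fin n) (Fin n) ℝ | X.PosSemidef ∧ (1 - X).PosSemidef ∧ X.trace = N}) := by
  refine ⟨-(n * specNorm C) - betaInv β * (n * Real.log 2), ?_⟩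
  rintro _ ⟨X, hX, rfl⟩
  exact freeEnergy_lower_bound hC hV β ⟨hX.1, hX.2.1⟩

theorem optValue_le (hC : C.IsHermitian) (hV : V.PosSemidef) {X : Matrix (Fin n) (Fin n) ℝ}
    (hX : X ∈ occupations n) (htr : X.trace = N) :
    optValue C V Ψ β N ≤ freeEnergy C V Ψ β X :=
  csInf_le (bddBelow_freeEnergy hC hV) ⟨X, ⟨hX.1, hX.2, htr⟩, rfl⟩

theorem exists_freeEnergy_lt (hN : 0 < N) (hNn : N < n) {ε : ℝ} (hε : 0 < ε) :
    ∃ X ∈ occupations n, X.trace = N ∧ freeEnergy C V Ψ β X < optValue C V Ψ β N + ε := by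
  have hn : (0 : ℝ) < n := hN.trans hNn
  have hne : (freeEnergy C V Ψ β ''
      {X : Matrix (Fin n) (Fin n) ℝ | X.PosSemidef ∧ (1 - X).PosSemidef ∧ X.trace = N}).Nonempty := by
    refine Set.Nonempty.image _ ⟨(N / n) • 1, PosSemidef.one.smul (by positivity), ?_, ?_⟩
    · have : (1 : Matrix (Fin n) (Fin n) ℝ) - (N / n) • 1 = (1 - N / n) • 1 := by
        rw [sub_smul, one_smul]
      rw [this]
      exact PosSemidef.one.smul (sub_nonneg.2 ((div_le_one hn).2 hNn.le))
    · rw [trace_smul, trace_one, Fintype.card_fin, smul_eq_mul, div_mul_cancel₀ _ hn.ne']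
  obtain ⟨_, ⟨X, hX, rfl⟩, h⟩ := exists_lt_of_csInf_lt hne (lt_add_of_pos_right _ hε)
  exact ⟨X, ⟨hX.1, hX.2.1⟩, hX.2.2, h⟩

/-- Jensen with uniform weights: at fixed total mass the entropy is largest for the flat
distribution. This is the source of the log(1/γ) and log(1/(1-γ)) in the a priori interval. -/
theorem sum_negMulLog_le (hn : 0 < n) {y : Fin n → ℝ} (hy : ∀ i, 0 ≤ y i) {M : ℝ} (hM : 0 < M)
    (hsum : ∑ i, y i = M) :
    ∑ i, Real.negMulLog (y i) ≤ M * Real.log ((M / n)⁻¹) := by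
  have hn' : (0 : ℝ) < n := by exact_mod_cast hn
  have h := Real.concaveOn_negMulLog.le_map_sum (t := Finset.univ) (w := fun _ : Fin n => (n : ℝ)⁻¹)
    (p := y) (fun _ _ => by positivity) (by simp [hn'.ne']) (fun i _ => hy i)
  simp only [smul_eq_mul, ← Finset.mul_sum, hsum] at h
  rw [inv_mul_le_iff₀ hn'] at h
  refine h.trans_eq ?_
  rw [Real.negMulLog, Real.log_inv, div_eq_inv_mul]
  field_simp

/-- Moving a fraction ε towards I adds trace ε(n - N). Up to the log(1-ε) correction, `muRight`
bounds the free energy paid per unit of added trace, so it will bound the multiplier from above.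
`freeEnergy_toward_zero` is the mirror image for `muLeft`. -/
theorem freeEnergy_toward_one (hC : C.IsHermitian) (hV : V.PosSemidef) (hΨ : Ψᵀ * Ψ = 1)
    (hn : 0 < n) (hNn : N < n) {X : Matrix (Fin n) (Fin n) ℝ} (hX : X ∈ occupations n)
    (htr : X.trace = N) {ε : ℝ} (hε : ε ∈ Set.Ioo (0 : ℝ) 1) :
    freeEnergy C V Ψ β ((1 - ε) • X + ε • 1) - freeEnergy C V Ψ β X ≤
      ε * (n - N) * (muRight C V Ψ β N - betaInv β * Real.log (1 - ε)) := by
  have hn' : (0 : ℝ) < n := by exact_mod_cast hn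
  have h1mem : (1 : Matrix (Fin n) (Fin n) ℝ) ∈ occupations n :=
    ⟨PosSemidef.one, by rw [sub_self]; exact PosSemidef.zero⟩
  have hX' : (1 - ε) • X + ε • 1 ∈ occupations n :=
    convex_occupations n hX h1mem (sub_nonneg.2 hε.2.le) hε.1.le (by ring)
  have hd : (1 - ε) • X + ε • 1 - X = ε • (1 - X) := by
    rw [sub_smul, one_smul, smul_sub]; abel
  have htr1 : (1 - X).trace = n - N := by
    rw [trace_sub, trace_one, Fintype.card_fin, htr]
  -- linear part
  have hlin : (C * ((1 - ε) • X + ε • 1)).trace - (C * X).trace ≤ ε * (eigMax C * (n - N)) := by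
    rw [← trace_sub, ← Matrix.mul_sub, hd, Matrix.mul_smul, trace_smul, smul_eq_mul, ← htr1]
    exact mul_le_mul_of_nonneg_left (trace_mul_le_eigMax hC hX.2) hε.1.le
  -- Hartree part
  have hH : hartreeEnergy V Ψ ((1 - ε) • X + ε • 1) - hartreeEnergy V Ψ X
      ≤ ε * (cHartree V Ψ * (n - N)) := by
    -- The tangent is taken at the new point, where convexity bounds the increase from above; the
    -- potential there is still at most c_h because the new point is feasible.
    have h := hartreeEnergy_tangent Ψ hV ((1 - ε) • X + ε • 1) X
    have hd' : X - ((1 - ε) • X + ε • 1) = (-ε) • (1 - X) := by rw [neg_smul, ← hd, neg_sub]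
    rw [hd', density_smul, dotProduct_smul, smul_eq_mul] at h
    have h2 : (V *ᵥ density Ψ ((1 - ε) • X + ε • 1)) ⬝ᵥ density Ψ (1 - X)
        ≤ cHartree V Ψ * (n - N) := by
      rw [← htr1, ← sum_density hΨ, Finset.mul_sum]
      refine Finset.sum_le_sum fun p _ => mul_le_mul_of_nonneg_right
        ((le_abs_self _).trans (abs_mulVec_density_le V hX' p)) ?_
      refine (density_mem_Icc (X := 1 - X) ⟨hX.2, ?_⟩ p).1
      rw [sub_sub_cancel]; exact hX.1
    have := mul_le_mul_of_nonneg_left h2 hε.1.le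
    linarith
  -- entropy part
  have hS : fermiDirac ((1 - ε) • X + ε • 1) - fermiDirac X
      ≤ ε * ((n - N) * (-Real.log (1 - ε) + Real.log ((1 - N / n)⁻¹))) := by
    obtain ⟨U, x, h⟩ := hX.1.isHermitian.exists_isSpectral
    have hsum : ∑ i, (1 - x i) = n - N := by
      rw [Finset.sum_sub_distrib, ← h.trace_eq, htr]; simp
    have e : (1 - ε) • X + ε • 1 = cfc (fun x : ℝ => (1 - ε) * x + ε) X := by
      rw [cfc_add X (fun x : ℝ => (1 - ε) * x) (fun _ => ε) (continuousOn_spectrum _ _)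
        (continuousOn_spectrum _ _), cfc_const_mul_id (1 - ε) X h.isHermitian.isSelfAdjoint,
        cfc_const ε X h.isHermitian.isSelfAdjoint, Algebra.algebraMap_eq_smul_one]
    rw [e, h.fermiDirac_cfc, h.fermiDirac_eq, ← Finset.sum_sub_distrib]
    refine (Finset.sum_le_sum fun i _ => neg_binEntropy_toward_one (h.mem_Icc hX i) hε).trans ?_
    rw [← Finset.mul_sum, Finset.sum_add_distrib, ← Finset.sum_mul, hsum]
    have := sum_negMulLog_le hn (y := fun i => 1 - x i) (fun i => sub_nonneg.2 (h.mem_Icc hX i).2)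
      (sub_pos.2 hNn) hsum
    rw [sub_div, div_self hn'.ne'] at this
    exact mul_le_mul_of_nonneg_left (by linarith) hε.1.le
  have hS' := mul_le_mul_of_nonneg_left hS (betaInv_nonneg β)
  simp only [freeEnergy, energy, muRight]
  linarith

theorem freeEnergy_toward_zero (hC : C.IsHermitian) (hV : V.PosSemidef) (hΨ : Ψᵀ * Ψ = 1)
    (hn : 0 < n) (hN : 0 < N) {X : Matrix (Fin n) (Fin n) ℝ} (hX : X ∈ occupations n)
    (htr : X.trace = N) {ε : ℝ} (hε : ε ∈ Set.Ioo (0 : ℝ) 1) :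
    freeEnergy C V Ψ β ((1 - ε) • X) - freeEnergy C V Ψ β X ≤
      ε * N * (-muLeft C V Ψ β N - betaInv β * Real.log (1 - ε)) := by
  have h0mem : (0 : Matrix (Fin n) (Fin n) ℝ) ∈ occupations n :=
    ⟨PosSemidef.zero, by rw [sub_zero]; exact PosSemidef.one⟩
  have hX' : (1 - ε) • X ∈ occupations n := by
    have := convex_occupations n hX h0mem (sub_nonneg.2 hε.2.le) hε.1.le (by ring)
    rwa [smul_zero, add_zero] at this
  have hd : X - (1 - ε) • X = ε • X := by
    rw [sub_smul, one_smul]; abel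
  have hlin : (C * ((1 - ε) • X)).trace - (C * X).trace ≤ -(ε * (eigMin C * N)) := by
    have := mul_le_mul_of_nonneg_left (eigMin_mul_trace_le hC hX.1) hε.1.le
    rw [htr] at this
    rw [Matrix.mul_smul, trace_smul, smul_eq_mul]
    linarith
  have hH : hartreeEnergy V Ψ ((1 - ε) • X) - hartreeEnergy V Ψ X ≤ ε * (cHartree V Ψ * N) := by
    have h := hartreeEnergy_tangent Ψ hV ((1 - ε) • X) X
    rw [hd, density_smul Ψ ε, dotProduct_smul, smul_eq_mul] at h
    have h2 : -(cHartree V Ψ * N) ≤ (V *ᵥ density Ψ ((1 - ε) • X)) ⬝ᵥ density Ψ X := by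
      rw [← htr, ← sum_density hΨ, Finset.mul_sum, ← Finset.sum_neg_distrib]
      refine Finset.sum_le_sum fun p _ => ?_
      rw [← neg_mul]
      exact mul_le_mul_of_nonneg_right (abs_le.1 (abs_mulVec_density_le V hX' p)).1
        (density_mem_Icc hX p).1
    have := mul_le_mul_of_nonneg_left h2 hε.1.le
    linarith
  have hS : fermiDirac ((1 - ε) • X) - fermiDirac X
      ≤ ε * (N * (-Real.log (1 - ε) + Real.log ((N / n)⁻¹))) := by
    obtain ⟨U, x, h⟩ := hX.1.isHermitian.exists_isSpectral
    have hsum : ∑ i, x i = N := by rw [← h.trace_eq, htr]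
    have e : (1 - ε) • X = cfc (fun x : ℝ => (1 - ε) * x) X := by
      rw [cfc_const_mul_id (1 - ε) X h.isHermitian.isSelfAdjoint]
    rw [e, h.fermiDirac_cfc, h.fermiDirac_eq, ← Finset.sum_sub_distrib]
    refine (Finset.sum_le_sum fun i _ => neg_binEntropy_toward_zero (h.mem_Icc hX i) hε).trans ?_
    rw [← Finset.mul_sum, Finset.sum_add_distrib, ← Finset.sum_mul, hsum]
    have := sum_negMulLog_le hn (fun i => (h.mem_Icc hX i).1) hN hsum
    exact mul_le_mul_of_nonneg_left (by linarith) hε.1.le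
  have hS' := mul_le_mul_of_nonneg_left hS (betaInv_nonneg β)
  simp only [freeEnergy, energy, muLeft]
  linarith

theorem log_filling_nonneg (hN : 0 < N) (hNn : N < n) :
    0 ≤ Real.log ((N / n)⁻¹) ∧ 0 ≤ Real.log ((1 - N / n)⁻¹) := by
  have hn : (0 : ℝ) < n := hN.trans hNn
  have h1 : N / n < 1 := (div_lt_one hn).2 hNn
  have h0 : 0 < N / n := by positivity
  exact ⟨Real.log_nonneg ((one_le_inv₀ h0).2 h1.le),
    Real.log_nonneg ((one_le_inv₀ (by linarith)).2 (by linarith))⟩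

/-- Slopes below `N` are at most slopes above `N`. -/
theorem left_slope_le_right_slope (hC : C.IsHermitian) (hV : V.PosSemidef)
    {X Y : Matrix (Fin n) (Fin n) ℝ} (hX : X ∈ occupations n) (hY : Y ∈ occupations n)
    (hXN : X.trace < N) (hYN : N < Y.trace) :
    (optValue C V Ψ β N - freeEnergy C V Ψ β X) / (N - X.trace) ≤
      (freeEnergy C V Ψ β Y - optValue C V Ψ β N) / (Y.trace - N) := by
  have hxy : 0 < Y.trace - X.trace := by linarith
  set s := (Y.trace - N) / (Y.trace - X.trace) with hs
  set t := (N - X.trace) / (Y.trace - X.trace) with ht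
  have hs0 : 0 ≤ s := div_nonneg (by linarith) hxy.le
  have ht0 : 0 ≤ t := div_nonneg (by linarith) hxy.le
  have hst : s + t = 1 := by rw [hs, ht, ← add_div, div_eq_one_iff_eq hxy.ne']; ring
  have htr : (s • X + t • Y).trace = N := by
    rw [trace_add, trace_smul, trace_smul, smul_eq_mul, smul_eq_mul, hs, ht]
    field_simp; ring
  have h1 := optValue_le (Ψ := Ψ) (β := β) hC hV (convex_occupations n hX hY hs0 ht0 hst) htr
  have h2 := h1.trans ((convexOn_freeEnergy hV β).2 hX hY hs0 ht0 hst)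
  rw [smul_eq_mul, smul_eq_mul, hs, ht, div_mul_eq_mul_div, div_mul_eq_mul_div, ← add_div,
    le_div_iff₀ hxy] at h2
  rw [div_le_div_iff₀ (by linarith) (by linarith)]
  linarith

/-- Strong duality, with an optimal chemical potential in the a priori interval. -/
theorem exists_chemicalPotential (hC : C.IsHermitian) (hV : V.PosSemidef) (hΨ : Ψᵀ * Ψ = 1)
    (hN : 0 < N) (hNn : N < n) :
    ∃ ν ∈ Set.Icc (muLeft C V Ψ β N) (muRight C V Ψ β N), ∀ X ∈ occupations n,
      optValue C V Ψ β N ≤ freeEnergy C V Ψ β X - ν * (X.trace - N) := by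
  have hn' : (0 : ℝ) < n := hN.trans hNn
  have hn : 0 < n := by exact_mod_cast hn'
  set p := optValue C V Ψ β N with hp
  set F := freeEnergy C V Ψ β with hF
  have hc : 0 ≤ cHartree V Ψ := by
    have := Real.iSup_nonneg (f := fun p => ∑ i, |Ψ p i| ^ 2) fun p =>
      Finset.sum_nonneg fun i _ => by positivity
    have := Real.iSup_nonneg (f := fun p => ∑ q, |V p q|) fun p =>
      Finset.sum_nonneg fun i _ => by positivity
    exact mul_nonneg ‹_› ‹_›
  have hLR : muLeft C V Ψ β N ≤ muRight C V Ψ β N := by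
    have h1 := mul_nonneg (betaInv_nonneg β) (log_filling_nonneg hN hNn).1
    have h2 := mul_nonneg (betaInv_nonneg β) (log_filling_nonneg hN hNn).2
    have h3 := (eigMin_eigMax_bounds hC hn).2.1
    rw [muLeft, muRight]; linarith
  -- Both slope estimates carry a log(1-ε) correction and an error ε/c from using a near-minimizer;
  -- both vanish as ε decreases to 0.
  have hlim : ∀ (a c : ℝ), Filter.Tendsto (fun ε : ℝ => a + betaInv β * Real.log (1 - ε) - ε / c)
      (nhdsWithin 0 (Set.Ioi 0)) (nhds a) := by
    intro a c
    have : ContinuousAt (fun ε : ℝ => a + betaInv β * Real.log (1 - ε) - ε / c) 0 := by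
      have : ContinuousAt (fun ε : ℝ => Real.log (1 - ε)) 0 :=
        ContinuousAt.log (by fun_prop) (by norm_num)
      fun_prop
    have h := this.tendsto
    simp only [sub_zero, Real.log_one, mul_zero, add_zero, zero_div] at h
    exact h.mono_left nhdsWithin_le_nhds
  have hmem : Set.Ioo (0 : ℝ) 1 ∈ nhdsWithin (0 : ℝ) (Set.Ioi 0) := Ioo_mem_nhdsGT one_pos
  have hleft : ∀ Y ∈ occupations n, N < Y.trace →
      muLeft C V Ψ β N ≤ (F Y - p) / (Y.trace - N) := by
    intro Y hY hYN
    refine le_of_tendsto (hlim (muLeft C V Ψ β N) N) ?_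
    filter_upwards [hmem] with ε hε
    -- The infimum need not be known to be attained: a slack of ε², divided by the trace change εN,
    -- costs only ε/N.
    obtain ⟨X, hX, htr, hlt⟩ := exists_freeEnergy_lt (C := C) (V := V) (Ψ := Ψ) (β := β) hN hNn
      (mul_pos hε.1 hε.1)
    have h0mem : (0 : Matrix (Fin n) (Fin n) ℝ) ∈ occupations n :=
      ⟨PosSemidef.zero, by rw [sub_zero]; exact PosSemidef.one⟩
    have hX' : (1 - ε) • X ∈ occupations n := by
      have := convex_occupations n hX h0mem (sub_nonneg.2 hε.2.le) hε.1.le (by ring)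
      rwa [smul_zero, add_zero] at this
    have htr' : ((1 - ε) • X).trace = (1 - ε) * N := by rw [trace_smul, htr, smul_eq_mul]
    have h1 := freeEnergy_toward_zero (β := β) hC hV hΨ hn hN hX htr hε
    have hεN : 0 < ε * N := mul_pos hε.1 hN
    refine le_trans ?_ (left_slope_le_right_slope hC hV hX' hY (by rw [htr']; linarith) hYN)
    rw [htr', show N - (1 - ε) * N = ε * N by ring, le_div_iff₀ hεN]
    have e : (muLeft C V Ψ β N + betaInv β * Real.log (1 - ε) - ε / N) * (ε * N) =
      -(ε * N * (-muLeft C V Ψ β N - betaInv β * Real.log (1 - ε))) - ε * ε := by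
      field_simp; ring
    rw [e]
    linarith
  have hright : ∀ Y ∈ occupations n, Y.trace < N →
      (p - F Y) / (N - Y.trace) ≤ muRight C V Ψ β N := by
    intro Y hY hYN
    rw [← neg_le_neg_iff]
    refine le_of_tendsto (hlim (-muRight C V Ψ β N) (n - N)) ?_
    filter_upwards [hmem] with ε hε
    obtain ⟨X, hX, htr, hlt⟩ := exists_freeEnergy_lt (C := C) (V := V) (Ψ := Ψ) (β := β) hN hNn
      (mul_pos hε.1 hε.1)
    have h1mem : (1 : Matrix (Fin n) (Fin n) ℝ) ∈ occupations n :=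
      ⟨PosSemidef.one, by rw [sub_self]; exact PosSemidef.zero⟩
    have hX' : (1 - ε) • X + ε • 1 ∈ occupations n :=
      convex_occupations n hX h1mem (sub_nonneg.2 hε.2.le) hε.1.le (by ring)
    have htr' : ((1 - ε) • X + ε • (1 : Matrix (Fin n) (Fin n) ℝ)).trace
        = (1 - ε) * N + ε * n := by
      rw [trace_add, trace_smul, htr, trace_smul, trace_one, Fintype.card_fin, smul_eq_mul,
        smul_eq_mul]
    have h1 := freeEnergy_toward_one (β := β) hC hV hΨ hn hNn hX htr hε
    have hεN : 0 < ε * (n - N) := mul_pos hε.1 (sub_pos.2 hNn)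
    have hnN := (sub_pos.2 hNn).ne'
    refine le_trans ?_ (neg_le_neg (left_slope_le_right_slope hC hV hY hX' hYN
      (by rw [htr']; linarith)))
    rw [htr', show (1 - ε) * N + ε * n - N = ε * (n - N) by ring, le_neg, div_le_iff₀ hεN]
    have e : -(-muRight C V Ψ β N + betaInv β * Real.log (1 - ε) - ε / (n - N)) * (ε * (n - N)) =
      ε * (n - N) * (muRight C V Ψ β N - betaInv β * Real.log (1 - ε)) + ε * ε := by
      field_simp; ring
    rw [e]
    linarith
  -- A subgradient of the value function at N is a number separating all left slopes from all right
  -- slopes. Adding the two end points to the families forces ν into the a priori interval and makes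
  -- both families nonempty.
  obtain ⟨ν, hν1, hν2⟩ := exists_between_of_forall_le
    (s := insert (muLeft C V Ψ β N)
      ((fun X => (p - F X) / (N - X.trace)) '' {X | X ∈ occupations n ∧ X.trace < N}))
    (t := insert (muRight C V Ψ β N)
      ((fun X => (F X - p) / (X.trace - N)) '' {X | X ∈ occupations n ∧ N < X.trace}))
    (Set.insert_nonempty _ _) (Set.insert_nonempty _ _) (by
      rintro _ (rfl | ⟨X, hX, rfl⟩) _ (rfl | ⟨Y, hY, rfl⟩)
      · exact hLR
      · exact hleft Y hY.1 hY.2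
      · exact hright X hX.1 hX.2
      · exact left_slope_le_right_slope hC hV hX.1 hY.1 hX.2 hY.2)
  refine ⟨ν, ⟨hν1 (Set.mem_insert _ _), hν2 (Set.mem_insert _ _)⟩, fun X hX => ?_⟩
  rcases lt_trichotomy X.trace N with h | h | h
  · have := hν1 (Set.mem_insert_of_mem _ ⟨X, ⟨hX, h⟩, rfl⟩)
    rw [div_le_iff₀ (by linarith)] at this
    linarith
  · rw [h, sub_self, mul_zero, sub_zero]
    exact optValue_le hC hV hX h
  · have := hν2 (Set.mem_insert_of_mem _ ⟨X, ⟨hX, h⟩, rfl⟩)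
    rw [le_div_iff₀ (by linarith)] at this
    linarith

end

/-! ### Regret of mirror descent -/

section

variable {n m : ℕ} {C : Matrix (Fin n) (Fin n) ℝ} {V : Matrix (Fin m) (Fin m) ℝ}
  {Ψ : Matrix (Fin m) (Fin n) ℝ} {β : ℝ≥0∞}

/-- Bregman divergence of the Fermi-Dirac entropy, as a function of the dual variable. -/
noncomputable def bregman (X Y : Matrix (Fin n) (Fin n) ℝ) : ℝ :=
  fermiDirac X - fermiDirac (invMirrorMap Y) - (Y * (X - invMirrorMap Y)).trace

theorem bregman_nonneg {X Y : Matrix (Fin n) (Fin n) ℝ} (hX : X ∈ occupations n)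
    (hY : Y.IsHermitian) : 0 ≤ bregman X Y := by
  refine le_trans ?_ (two_mul_trace_sq_le_bregman hX hY)
  have hD : (X - invMirrorMap Y).IsHermitian := hX.1.isHermitian.sub (isHermitian_cfc _ _)
  obtain ⟨U, d, h⟩ := hD.exists_isSpectral
  rw [trace_sq_eq h]
  positivity

/-- Young's inequality for a matrix with bounded quadratic form. -/
theorem mul_trace_mul_le {H D : Matrix (Fin n) (Fin n) ℝ} {d η : ℝ} (hη : 0 ≤ η)
    (hD : D.IsHermitian)
    (hH : ∀ U : Matrix (Fin n) (Fin n) ℝ, Uᵀ * U = 1 → ∀ i, |(Uᵀ * H * U) i i| ≤ d) :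
    η * (H * D).trace ≤ 2 * (D * D).trace + n * (η ^ 2 * d ^ 2 / 8) := by
  obtain ⟨U, δ, h⟩ := hD.exists_isSpectral
  rw [trace_sq_eq h, trace_mul_comm, h.trace_mul, Finset.mul_sum, Finset.mul_sum]
  have : (n : ℝ) * (η ^ 2 * d ^ 2 / 8) = ∑ _i : Fin n, η ^ 2 * d ^ 2 / 8 := by simp
  rw [this, ← Finset.sum_add_distrib]
  refine Finset.sum_le_sum fun i _ => ?_
  have h1 : δ i * (Uᵀ * H * U) i i ≤ |δ i| * d := by
    refine (le_abs_self _).trans ?_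
    rw [abs_mul]
    exact mul_le_mul_of_nonneg_left (hH U h.transpose_mul i) (abs_nonneg _)
  have h2 := mul_le_mul_of_nonneg_left h1 hη
  -- The square divided by 8 is 2δ² - η|δ|d + η²d²/8; the coefficient 2 matches the strong convexity
  -- constant.
  nlinarith [sq_nonneg (4 * |δ i| - η * d), sq_abs (δ i)]

/-- The columns of ΨU are unit vectors, so each diagonal entry is an average of the potential values
(Vρ)_p. -/
theorem abs_conj_hartreeGrad_le (hΨ : Ψᵀ * Ψ = 1) {X : Matrix (Fin n) (Fin n) ℝ} {d : ℝ}
    (hd : ∀ p, |(V *ᵥ density Ψ X) p| ≤ d) {U : Matrix (Fin n) (Fin n) ℝ} (hU : Uᵀ * U = 1)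
    (i : Fin n) : |(Uᵀ * hartreeGrad V Ψ X * U) i i| ≤ d := by
  have e : Uᵀ * hartreeGrad V Ψ X * U = (Ψ * U)ᵀ * diagonal (V *ᵥ density Ψ X) * (Ψ * U) := by
    rw [hartreeGrad_eq, Matrix.transpose_mul]; simp only [Matrix.mul_assoc]
  have hone : ∑ p, (Ψ * U) p i ^ 2 = 1 := by
    have : (Ψ * U)ᵀ * (Ψ * U) = 1 := by
      rw [Matrix.transpose_mul, Matrix.mul_assoc, ← Matrix.mul_assoc Ψᵀ, hΨ, Matrix.one_mul, hU]
    have := congrFun (congrFun this i) i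
    rw [Matrix.mul_apply, one_apply_eq] at this
    simpa [pow_two] using this
  rw [e, Matrix.mul_apply]
  simp only [mul_diagonal, transpose_apply]
  refine (Finset.abs_sum_le_sum_abs _ _).trans ?_
  rw [← mul_one d, ← hone, Finset.mul_sum]
  refine Finset.sum_le_sum fun p _ => ?_
  rw [mul_right_comm, abs_mul, ← pow_two, abs_of_nonneg (sq_nonneg ((Ψ * U) p i)), mul_comm]
  exact mul_le_mul_of_nonneg_right (hd p) (sq_nonneg _)

variable {b η μ d : ℝ} {H Y : ℕ → Matrix (Fin n) (Fin n) ℝ}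

/-- The update says (1 + ηb) Y' = Y - ηG, an implicit step for the entropy term. Substituting for ηG
gives the three-point identity of Bregman divergences plus an extra divergence coming from the
entropy. -/
theorem mirror_step_identity (hb : 0 ≤ b) (hη : 0 < η) {Y Y' G X : Matrix (Fin n) (Fin n) ℝ}
    (hrec : Y' = (1 - b * (η / (1 + η * b))) • Y - (η / (1 + η * b)) • G) :
    η * (G * (invMirrorMap Y' - X)).trace
        + η * b * (fermiDirac (invMirrorMap Y') - fermiDirac X)
      = bregman X Y - bregman X Y' - bregman (invMirrorMap Y') Y - η * b * bregman X Y' := by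
  have hpos : 0 < 1 + η * b := by positivity
  have hG : η • G = Y - (1 + η * b) • Y' := by
    rw [hrec, smul_sub, smul_smul, smul_smul, show (1 + η * b) * (1 - b * (η / (1 + η * b))) = 1 by
      field_simp; ring, mul_div_cancel₀ _ hpos.ne', one_smul, sub_sub_cancel]
  rw [← smul_eq_mul η, ← trace_smul, ← Matrix.smul_mul, hG]
  simp only [bregman, Matrix.sub_mul, Matrix.mul_sub, Matrix.smul_mul, trace_sub, trace_smul,
    smul_eq_mul]
  ring

theorem mirror_descent_regret (hb : 0 ≤ b) (hη : 0 < η) {G₀ : Matrix (Fin n) (Fin n) ℝ}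
    (hYh : ∀ t, (Y t).IsHermitian) (hY0 : Y 0 = 0)
    (hrec : ∀ t, Y (t + 1) = (1 - b * (η / (1 + η * b))) • Y t
      - (η / (1 + η * b)) • (H t + G₀)) (T : ℕ)
    (hH : ∀ t < T, ∀ U : Matrix (Fin n) (Fin n) ℝ, Uᵀ * U = 1 →
      ∀ i, |(Uᵀ * H t * U) i i| ≤ d) {X : Matrix (Fin n) (Fin n) ℝ} (hX : X ∈ occupations n) :
    η * ∑ t ∈ Finset.range T, (((H t + G₀) * (invMirrorMap (Y t) - X)).trace
        + b * (fermiDirac (invMirrorMap (Y t)) - fermiDirac X)) ≤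
      n * Real.log 2 + η * (G₀ * (invMirrorMap (Y 0) - invMirrorMap (Y T))).trace
        + T * (n * (η ^ 2 * d ^ 2 / 8)) := by
  set P : ℕ → Matrix (Fin n) (Fin n) ℝ := fun t => invMirrorMap (Y t) with hP
  -- The step identity controls G₀ and the entropy at P (t+1), but the regret needs them at P t.
  -- Putting both into the potential makes the shift telescope, so only H t has to be paid for by
  -- Young's inequality.
  set Φ : ℕ → ℝ := fun t => bregman X (Y t) + η * (G₀ * P t).trace + η * b * fermiDirac (P t)
    with hΦ
  have hPmem : ∀ t, P t ∈ occupations n := fun t => invMirrorMap_mem_occupations (hYh t)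
  have step : ∀ t < T, η * (((H t + G₀) * (P t - X)).trace + b * (fermiDirac (P t) - fermiDirac X))
      ≤ Φ t - Φ (t + 1) + n * (η ^ 2 * d ^ 2 / 8) := by
    intro t ht
    have h1 := mirror_step_identity (X := X) hb hη (hrec t)
    have h2 := two_mul_trace_sq_le_bregman (hPmem (t + 1)) (hYh t)
    have h3 := mul_trace_mul_le hη.le
      ((hPmem t).1.isHermitian.sub (hPmem (t + 1)).1.isHermitian) (hH t ht)
    have h4 := mul_nonneg (mul_nonneg hη.le hb) (bregman_nonneg hX (hYh (t + 1)))
    have e : (P t - P (t + 1)) * (P t - P (t + 1))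
        = (P (t + 1) - invMirrorMap (Y t)) * (P (t + 1) - invMirrorMap (Y t)) := by
      rw [← neg_sub (P (t + 1)), neg_mul_neg]
    rw [e] at h3
    simp only [hΦ]
    have h2' : 2 * ((P (t + 1) - invMirrorMap (Y t)) * (P (t + 1) - invMirrorMap (Y t))).trace
      ≤ bregman (P (t + 1)) (Y t) := h2
    have e2 : ((H t + G₀) * (P t - X)).trace = ((H t + G₀) * (P (t + 1) - X)).trace
        + (H t * (P t - P (t + 1))).trace + (G₀ * P t).trace - (G₀ * P (t + 1)).trace := by
      simp only [Matrix.add_mul, Matrix.mul_sub, trace_add, trace_sub]; ring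
    rw [e2]
    have h1' : η * ((H t + G₀) * (P (t + 1) - X)).trace
        + η * b * (fermiDirac (P (t + 1)) - fermiDirac X) = bregman X (Y t) - bregman X (Y (t + 1))
          - bregman (P (t + 1)) (Y t) - η * b * bregman X (Y (t + 1)) := h1
    linarith
  have hsum := Finset.sum_le_sum fun t ht => step t (Finset.mem_range.1 ht)
  rw [← Finset.mul_sum, Finset.sum_add_distrib (f := fun t => Φ t - Φ (t + 1)),
    Finset.sum_range_sub', Finset.sum_const,
    Finset.card_range, nsmul_eq_mul] at hsum
  refine hsum.trans ?_
  have hP0 : fermiDirac (P 0) = -(n * Real.log 2) := by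
    have hP0' : P 0 = cfc (fun y : ℝ => (1 + Real.exp (-y))⁻¹) (0 : Matrix (Fin n) (Fin n) ℝ) := by
      rw [← hY0]; rfl
    obtain ⟨U, y, h⟩ := (isHermitian_zero (n := Fin n) (α := ℝ)).exists_isSpectral
    have hy : ∀ i, y i = 0 := fun i => by
      rw [← h.eigenvalue_eq i]; simp
    rw [hP0', h.fermiDirac_cfc]
    simp only [hy, neg_zero, Real.exp_zero, one_add_one_eq_two, Real.binEntropy_two_inv]
    simp
  have hb0 : bregman X (Y 0) ≤ n * Real.log 2 := by
    have h1 : bregman X (Y 0) = fermiDirac X - fermiDirac (P 0) := by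
      rw [bregman, hY0]; simp [hP, hY0]
    rw [h1, hP0]; linarith [fermiDirac_nonpos hX]
  have hbT := bregman_nonneg hX (hYh T)
  -- The starting point I/2 attains the minimum -n log 2 of the entropy, so this boundary term has
  -- the favourable sign.
  have hS : η * b * fermiDirac (P 0) ≤ η * b * fermiDirac (P T) :=
    mul_le_mul_of_nonneg_left (hP0 ▸ neg_log_two_le_fermiDirac (hPmem T).1.isHermitian)
      (by positivity)
  simp only [hΦ, Matrix.mul_sub, trace_sub]
  linarith

/-! ### The iterates -/

/-- The mirror descent step in the dual variable `Y = ∇S_FD(X)`. -/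
noncomputable def dualStep (C : Matrix (Fin n) (Fin n) ℝ) (V : Matrix (Fin m) (Fin m) ℝ)
    (Ψ : Matrix (Fin m) (Fin n) ℝ) (b μ s : ℝ) (Y : Matrix (Fin n) (Fin n) ℝ) (z : Fin n → ℝ) :
    Matrix (Fin n) (Fin n) ℝ :=
  (1 - b * s) • Y - s • (gradEst C V Ψ (invMirrorMap Y) z - μ • 1)

theorem isHermitian_dualStep (hC : C.IsHermitian) {b μ s : ℝ} {Y : Matrix (Fin n) (Fin n) ℝ}
    (hY : Y.IsHermitian) (z : Fin n → ℝ) : (dualStep C V Ψ b μ s Y z).IsHermitian := by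
  rw [dualStep, gradEst]
  have hsmul : ∀ (c : ℝ) {A : Matrix (Fin n) (Fin n) ℝ}, A.IsHermitian → (c • A).IsHermitian :=
    fun c A hA => by rw [IsHermitian, conjTranspose_smul, star_trivial, hA.eq]
  exact (hsmul _ hY).sub (hsmul _ ((hC.add (isHermitian_hartreeGrad V Ψ _)).sub
    (hsmul _ isHermitian_one)))

/-- The sequence of states generated by a step function from an initial state and a noise
sequence. -/
def stateSeq {S Z : Type*} (step : S → Z → S) (y : S) (z : ℕ → Z) : ℕ → S
  | 0 => y
  | t + 1 => step (stateSeq step y z t) (z t)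

theorem isHermitian_stateSeq (hC : C.IsHermitian) {b μ s : ℝ} (z : ℕ → Fin n → ℝ) (t : ℕ) :
    (stateSeq (dualStep C V Ψ b μ s) 0 z t).IsHermitian := by
  induction t with
  | zero => exact isHermitian_zero
  | succ t ih => exact isHermitian_dualStep hC ih _

/-- In the dual variable the logarithmic map disappears, leaving only the smooth sigmoid;
measurability and regret are both handled there. -/
theorem iterate_eq (hC : C.IsHermitian) (β : ℝ≥0∞) {μ s : ℝ} (z : ℕ → Fin n → ℝ) (t : ℕ) :
    HartreeMD.iterate C V Ψ β μ s z t
      = invMirrorMap (stateSeq (dualStep C V Ψ (betaInv β) μ s) 0 z t) := by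
  induction t with
  | zero => exact invMirrorMap_zero.symm
  | succ t ih =>
    rw [HartreeMD.iterate, ih, mirrorMap_invMirrorMap (isHermitian_stateSeq hC z t)]
    rfl

theorem iterate_mem_occupations (hC : C.IsHermitian) (β : ℝ≥0∞) {μ s : ℝ} (z : ℕ → Fin n → ℝ)
    (t : ℕ) : HartreeMD.iterate C V Ψ β μ s z t ∈ occupations n := by
  rw [iterate_eq hC]
  exact invMirrorMap_mem_occupations (isHermitian_stateSeq hC z t)

theorem cesaro_mem_occupations (hC : C.IsHermitian) (β : ℝ≥0∞) {μ s : ℝ} (z : ℕ → Fin n → ℝ)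
    {T : ℕ} (hT : 1 ≤ T) : cesaro C V Ψ β μ s T z ∈ occupations n := by
  have hT' : (0 : ℝ) < T := by exact_mod_cast hT
  rw [cesaro, Finset.smul_sum]
  exact (convex_occupations n).sum_mem (fun _ _ => by positivity)
    (by simp [hT'.ne']) fun t _ => iterate_mem_occupations hC β z t

/-- The Gaussian amplitudes `Ψ X^{1/2} z`. -/
noncomputable def amplitude (Ψ : Matrix (Fin m) (Fin n) ℝ) (X : Matrix (Fin n) (Fin n) ℝ)
    (z : Fin n → ℝ) : Fin m → ℝ := Ψ *ᵥ (cfc Real.sqrt X *ᵥ z)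

/-- The error `⟨∇Ẽ(X) - ∇Ẽ(X̂), X - X'⟩` of the gradient estimator. -/
noncomputable def gradNoise (V : Matrix (Fin m) (Fin m) ℝ) (Ψ : Matrix (Fin m) (Fin n) ℝ)
    (X' X : Matrix (Fin n) (Fin n) ℝ) (z : Fin n → ℝ) : ℝ :=
  ∑ p, (V *ᵥ density Ψ (X - X')) p * (density Ψ X p - amplitude Ψ X z p ^ 2)

/-- Linearizing the Hartree energy at each iterate splits the gap into the regret against the random
gradient and `gradNoise`; Jensen passes from the average gap to the gap of the mean. -/
theorem freeEnergy_cesaro_le (hC : C.IsHermitian) (hV : V.PosSemidef) (hΨ : Ψᵀ * Ψ = 1)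
    (hη : 0 < η) {T : ℕ} (hT : 1 ≤ T) {z : ℕ → Fin n → ℝ}
    {X : Matrix (Fin n) (Fin n) ℝ} (hX : X ∈ occupations n) {r u : ℝ}
    (hr : ∀ t < T, ∀ p, amplitude Ψ (HartreeMD.iterate C V Ψ β μ (η / (1 + η * betaInv β)) z t)
      (z t) p ^ 2 ≤ r)
    (hu : ∑ t ∈ Finset.range T, gradNoise V Ψ X
      (HartreeMD.iterate C V Ψ β μ (η / (1 + η * betaInv β)) z t) (z t) ≤ u) :
    (freeEnergy C V Ψ β (cesaro C V Ψ β μ (η / (1 + η * betaInv β)) T z)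
        - μ * (cesaro C V Ψ β μ (η / (1 + η * betaInv β)) T z).trace)
      - (freeEnergy C V Ψ β X - μ * X.trace) ≤
      (n * Real.log 2 / η + n * (specNorm C + |μ|) + T * (n * (η * (r * maxRowSum V) ^ 2 / 8)) + u)
        / T := by
  have hT' : (0 : ℝ) < T := by exact_mod_cast hT
  set s := η / (1 + η * betaInv β) with hs
  set b := betaInv β with hb
  set P := HartreeMD.iterate C V Ψ β μ s z with hP
  set Y := stateSeq (dualStep C V Ψ b μ s) 0 z with hY
  have hPY : ∀ t, P t = invMirrorMap (Y t) := fun t => iterate_eq hC β z t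
  have hPmem : ∀ t, P t ∈ occupations n := fun t => iterate_mem_occupations hC β z t
  set H : ℕ → Matrix (Fin n) (Fin n) ℝ := fun t => hartreeGrad V Ψ
    (vecMulVec (cfc Real.sqrt (P t) *ᵥ z t) (cfc Real.sqrt (P t) *ᵥ z t)) with hH
  have hdens : ∀ t, density Ψ (vecMulVec (cfc Real.sqrt (P t) *ᵥ z t)
      (cfc Real.sqrt (P t) *ᵥ z t)) = fun p => amplitude Ψ (P t) (z t) p ^ 2 := fun t => by
    ext p; rw [density_vecMulVec]; rfl
  have hreg := mirror_descent_regret (b := b) (η := η) (G₀ := C - μ • 1) (Y := Y) (H := H)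
    (d := r * maxRowSum V) (betaInv_nonneg β) hη (fun t => isHermitian_stateSeq hC z t) rfl
    (fun t => by
      have : Y (t + 1) = dualStep C V Ψ b μ s (Y t) (z t) := rfl
      rw [this, dualStep, gradEst, ← hPY]
      simp only [hH, hs]
      congr 2; abel) T
    (fun t ht U hU i => abs_conj_hartreeGrad_le hΨ (fun p => abs_mulVec_le V (fun q => by
      rw [hdens, abs_of_nonneg (sq_nonneg _)]; exact hr t ht q) p) hU i) hX
  simp only [← hPY] at hreg
  have hlin : ((C - μ • 1) * (P 0 - P T)).trace ≤ n * (specNorm C + |μ|) := by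
    rw [Matrix.sub_mul, trace_sub, Matrix.smul_mul, Matrix.one_mul, trace_smul, smul_eq_mul]
    have h1 := (abs_le.1 (abs_trace_mul_sub_le hC (hPmem 0) (hPmem T))).2
    have h2 : |μ * (P 0 - P T).trace| ≤ |μ| * n := by
      rw [abs_mul]
      refine mul_le_mul_of_nonneg_left ?_ (abs_nonneg _)
      have h3 := trace_mem_Icc (hPmem 0)
      have h4 := trace_mem_Icc (hPmem T)
      rw [trace_sub, abs_le]; constructor <;> linarith [h3.1, h3.2, h4.1, h4.2]
    linarith [(abs_le.1 h2).1]
  have hgap : ∀ t, (freeEnergy C V Ψ β (P t) - μ * (P t).trace) - (freeEnergy C V Ψ β X - μ * X.trace)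
      ≤ (((H t + (C - μ • 1)) * (P t - X)).trace + b * (fermiDirac (P t) - fermiDirac X))
        + gradNoise V Ψ X (P t) (z t) := by
    intro t
    have h1 := hartreeEnergy_tangent Ψ hV (P t) X
    rw [← neg_sub (P t) X, ← neg_one_smul ℝ (P t - X), density_smul, dotProduct_smul,
      smul_eq_mul] at h1
    have hsymm : ∀ x y : Fin m → ℝ, (V *ᵥ x) ⬝ᵥ y = (V *ᵥ y) ⬝ᵥ x := fun x y => by
      rw [dotProduct_comm, dotProduct_mulVec, ← mulVec_transpose]
      have : Vᵀ = V := by simpa using hV.isHermitian.eq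
      rw [this]
    have h2 : gradNoise V Ψ X (P t) (z t) = (V *ᵥ density Ψ (P t)) ⬝ᵥ density Ψ (P t - X)
        - (H t * (P t - X)).trace := by
      rw [hH, trace_hartreeGrad_mul, hdens, hsymm (density Ψ (P t)),
        hsymm (fun p => amplitude Ψ (P t) (z t) p ^ 2), ← dotProduct_sub]
      rfl
    have h3 : ((C - μ • 1) * (P t - X)).trace = (C * P t).trace - (C * X).trace
        - μ * ((P t).trace - X.trace) := by
      rw [Matrix.sub_mul, trace_sub, Matrix.smul_mul, Matrix.one_mul, trace_smul, smul_eq_mul,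
        Matrix.mul_sub, trace_sub, trace_sub]
    rw [Matrix.add_mul, trace_add, h2, h3]
    simp only [freeEnergy, energy]
    linarith
  have hconv : (freeEnergy C V Ψ β (cesaro C V Ψ β μ s T z) - μ * (cesaro C V Ψ β μ s T z).trace)
      ≤ (∑ t ∈ Finset.range T, (freeEnergy C V Ψ β (P t) - μ * (P t).trace)) / T := by
    have h1 := (convexOn_freeEnergy (C := C) (Ψ := Ψ) hV β).map_sum_le (t := Finset.range T)
      (w := fun _ => 1 / (T : ℝ)) (p := P) (fun _ _ => by positivity) (by simp [hT'.ne'])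
      (fun t _ => hPmem t)
    rw [← Finset.smul_sum, ← Finset.smul_sum, smul_eq_mul] at h1
    have h2 : (cesaro C V Ψ β μ s T z).trace = (∑ t ∈ Finset.range T, (P t).trace) / T := by
      rw [cesaro, trace_smul, trace_sum, smul_eq_mul, one_div_mul_eq_div]
    rw [h2, Finset.sum_sub_distrib, ← Finset.mul_sum, sub_div, mul_div_assoc]
    rw [one_div_mul_eq_div] at h1
    exact sub_le_sub_right h1 _
  have hsum := Finset.sum_le_sum fun t (_ : t ∈ Finset.range T) => hgap t
  rw [Finset.sum_add_distrib, Finset.sum_sub_distrib, Finset.sum_const, Finset.card_range,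
    nsmul_eq_mul] at hsum
  have hreg' : ∑ t ∈ Finset.range T, (((H t + (C - μ • 1)) * (P t - X)).trace
      + b * (fermiDirac (P t) - fermiDirac X)) ≤
      n * Real.log 2 / η + n * (specNorm C + |μ|) + T * (n * (η * (r * maxRowSum V) ^ 2 / 8)) := by
    rw [← mul_le_mul_iff_right₀ hη]
    refine hreg.trans ?_
    have e : η * (n * Real.log 2 / η + n * (specNorm C + |μ|)
        + T * (n * (η * (r * maxRowSum V) ^ 2 / 8))) = n * Real.log 2 + η * (n * (specNorm C + |μ|))
        + T * (n * (η ^ 2 * (r * maxRowSum V) ^ 2 / 8)) := by field_simp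
    rw [e]
    linarith [mul_le_mul_of_nonneg_left hlin hη.le]
  rw [le_div_iff₀ hT']
  rw [le_div_iff₀ hT'] at hconv
  linarith

end

/-! ### Gaussian estimates -/

/-- The standard Gaussian measure on `ℝⁿ`. -/
noncomputable abbrev stdNormal (n : ℕ) : Measure (Fin n → ℝ) :=
  Measure.pi fun _ : Fin n => gaussianReal 0 1

theorem lintegral_exp_neg_mul_sq_gaussianReal {θ : ℝ} (hθ : 0 < 1 + 2 * θ) :
    ∫⁻ x, ENNReal.ofReal (Real.exp (-θ * x ^ 2)) ∂(gaussianReal 0 1)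
      = ENNReal.ofReal ((√(1 + 2 * θ))⁻¹) := by
  rw [gaussianReal_of_var_ne_zero _ one_ne_zero,
    lintegral_withDensity_eq_lintegral_mul _ (measurable_gaussianPDF 0 1) (by fun_prop)]
  have e : ∀ x : ℝ, (gaussianPDF 0 1 * fun x => ENNReal.ofReal (Real.exp (-θ * x ^ 2))) x
      = ENNReal.ofReal ((√(2 * Real.pi))⁻¹ * Real.exp (-(θ + 1 / 2) * x ^ 2)) := by
    intro x
    rw [Pi.mul_apply, gaussianPDF, ← ENNReal.ofReal_mul (gaussianPDFReal_nonneg _ _ _),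
      gaussianPDFReal]
    congr 1
    rw [mul_assoc, ← Real.exp_add]
    simp only [NNReal.coe_one, mul_one, sub_zero]
    congr 2; ring
  simp_rw [e]
  rw [← ofReal_integral_eq_lintegral_ofReal
    ((integrable_exp_neg_mul_sq (by linarith)).const_mul _) (ae_of_all _ fun x => by positivity),
    integral_const_mul, integral_gaussian]
  congr 1
  rw [← Real.sqrt_inv, ← Real.sqrt_inv, ← Real.sqrt_mul (by positivity)]
  congr 1
  have : θ + 1 / 2 = (1 + 2 * θ) / 2 := by ring
  rw [this]
  field_simp

theorem lintegral_exp_mul_one_sub_sq_le {θ : ℝ} (hθ : |θ| ≤ 1 / 4) :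
    ∫⁻ x, ENNReal.ofReal (Real.exp (θ * (1 - x ^ 2))) ∂(gaussianReal 0 1)
      ≤ ENNReal.ofReal (Real.exp (4 * θ ^ 2)) := by
  have hpos : 0 < 1 + 2 * θ := by linarith [(abs_le.1 hθ).1]
  have e : ∀ x : ℝ, ENNReal.ofReal (Real.exp (θ * (1 - x ^ 2)))
      = ENNReal.ofReal (Real.exp θ) * ENNReal.ofReal (Real.exp (-θ * x ^ 2)) := fun x => by
    rw [← ENNReal.ofReal_mul (Real.exp_pos _).le, ← Real.exp_add]
    congr 2; ring
  simp_rw [e]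
  rw [lintegral_const_mul _ (by fun_prop), lintegral_exp_neg_mul_sq_gaussianReal hpos,
    ← ENNReal.ofReal_mul (Real.exp_pos _).le]
  refine ENNReal.ofReal_le_ofReal ?_
  have h1 : (√(1 + 2 * θ))⁻¹ = Real.exp (-(Real.log (1 + 2 * θ) / 2)) := by
    rw [Real.exp_neg, ← Real.log_sqrt hpos.le, Real.exp_log (Real.sqrt_pos.2 hpos)]
  rw [h1, ← Real.exp_add, Real.exp_le_exp, ← sub_eq_add_neg]
  exact sub_half_log_one_add_le hθ

/-- Markov's inequality for exp(x²/4), whose mean is √2. -/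
theorem gaussianReal_sq_gt_le (τ : ℝ) :
    gaussianReal 0 1 {x | 4 * τ < x ^ 2} ≤ ENNReal.ofReal (√2 * Real.exp (-τ)) := by
  have h := mul_meas_ge_le_lintegral (μ := gaussianReal 0 1)
    (f := fun x : ℝ => ENNReal.ofReal (Real.exp (-(-1 / 4) * x ^ 2))) (by fun_prop)
    (ENNReal.ofReal (Real.exp τ))
  rw [lintegral_exp_neg_mul_sq_gaussianReal (by norm_num)] at h
  have hsub : {x : ℝ | 4 * τ < x ^ 2} ⊆
      {x | ENNReal.ofReal (Real.exp τ) ≤ ENNReal.ofReal (Real.exp (-(-1 / 4) * x ^ 2))} := by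
    intro x hx
    refine ENNReal.ofReal_le_ofReal (Real.exp_le_exp.2 ?_)
    have : 4 * τ < x ^ 2 := hx
    linarith
  have h2 : (√(1 + 2 * (-1 / 4)))⁻¹ = √(2 : ℝ) := by
    rw [← Real.sqrt_inv]; norm_num
  rw [h2] at h
  have h3 := (mul_le_mul_right (measure_mono (μ := gaussianReal 0 1) hsub)
    (ENNReal.ofReal (Real.exp τ))).trans h
  calc _ = ENNReal.ofReal (Real.exp (-τ)) *
        (ENNReal.ofReal (Real.exp τ) * gaussianReal 0 1 {x | 4 * τ < x ^ 2}) := by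
        rw [← mul_assoc, ← ENNReal.ofReal_mul (Real.exp_pos _).le, ← Real.exp_add]
        simp
    _ ≤ ENNReal.ofReal (Real.exp (-τ)) * ENNReal.ofReal √2 := by gcongr
    _ = _ := by rw [← ENNReal.ofReal_mul (Real.exp_pos _).le, mul_comm]

theorem map_dotProduct_stdNormal {n : ℕ} (v : Fin n → ℝ) :
    (stdNormal n).map (fun z => v ⬝ᵥ z) = (gaussianReal 0 1).map (fun x => √(∑ i, v i ^ 2) * x) := by
  set L : StrongDual ℝ (EuclideanSpace ℝ (Fin n)) := innerSL ℝ (WithLp.toLp 2 v) with hL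
  have h1 := IsGaussian.map_eq_gaussianReal (μ := stdGaussian (EuclideanSpace ℝ (Fin n))) L
  rw [integral_strongDual_stdGaussian, variance_dual_stdGaussian, ← map_pi_eq_stdGaussian,
    Measure.map_map (by fun_prop) (by fun_prop)] at h1
  have h2 : (L ∘ WithLp.toLp 2) = fun z : Fin n → ℝ => v ⬝ᵥ z := by
    ext z
    simp [hL, PiLp.inner_apply, dotProduct, mul_comm]
  rw [h2] at h1
  rw [h1, gaussianReal_map_const_mul, mul_zero, mul_one]
  congr 1
  ext
  rw [hL, innerSL_apply_norm, EuclideanSpace.norm_eq]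
  have hv : 0 ≤ ∑ i, v i ^ 2 := Finset.sum_nonneg fun i _ => sq_nonneg (v i)
  simp [Real.sq_sqrt hv, hv]

/-- The p-th amplitude is the product of z with row p of ΨX^{1/2}, whose squared norm is the
density. Everything about one amplitude thus reduces to one scalar Gaussian. -/
theorem lintegral_amplitude {n m : ℕ} {Ψ : Matrix (Fin m) (Fin n) ℝ}
    {X : Matrix (Fin n) (Fin n) ℝ} (hX : X ∈ occupations n) (p : Fin m) {f : ℝ → ℝ≥0∞}
    (hf : Measurable f) :
    ∫⁻ z, f (amplitude Ψ X z p ^ 2) ∂(stdNormal n)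
      = ∫⁻ x, f (density Ψ X p * x ^ 2) ∂(gaussianReal 0 1) := by
  set v : Fin n → ℝ := (Ψ * cfc Real.sqrt X) p with hv
  have hamp : ∀ z, amplitude Ψ X z p = v ⬝ᵥ z := fun z => by
    rw [amplitude, mulVec_mulVec]; rfl
  have hRR : cfc Real.sqrt X * cfc Real.sqrt X = X := by
    obtain ⟨U, x, h⟩ := hX.1.isHermitian.exists_isSpectral
    rw [← cfc_mul Real.sqrt Real.sqrt X (continuousOn_spectrum _ _) (continuousOn_spectrum _ _),
      h.cfc_eq]
    simp only [Real.mul_self_sqrt (h.mem_Icc hX _).1]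
    exact h.eq.symm
  have hsum : ∑ i, v i ^ 2 = density Ψ X p := by
    have hRt : (cfc Real.sqrt X)ᵀ = cfc Real.sqrt X := by
      simpa using (isHermitian_cfc Real.sqrt X).eq
    have : Ψ * X * Ψᵀ = (Ψ * cfc Real.sqrt X) * (Ψ * cfc Real.sqrt X)ᵀ := by
      rw [Matrix.transpose_mul, hRt]
      conv_lhs => rw [← hRR]
      simp only [Matrix.mul_assoc]
    rw [density, this, Matrix.mul_apply]
    simp [hv, pow_two]
  simp_rw [hamp]
  have h1 : ∫⁻ z, f ((v ⬝ᵥ z) ^ 2) ∂(stdNormal n)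
      = ∫⁻ y, f (y ^ 2) ∂((stdNormal n).map fun z => v ⬝ᵥ z) := by
    rw [lintegral_map (by fun_prop) (by simp only [dotProduct]; fun_prop)]
  rw [h1, map_dotProduct_stdNormal, lintegral_map (by fun_prop) (by fun_prop)]
  simp_rw [mul_pow, Real.sq_sqrt (Finset.sum_nonneg fun i _ => sq_nonneg (v i)), hsum]

theorem amplitude_eq_zero {n m : ℕ} {Ψ : Matrix (Fin m) (Fin n) ℝ}
    {X : Matrix (Fin n) (Fin n) ℝ} (hX : X ∈ occupations n) {p : Fin m} (h0 : density Ψ X p = 0) :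
    ∀ᵐ z ∂(stdNormal n), amplitude Ψ X z p ^ 2 = 0 := by
  have hm : Measurable fun z : Fin n → ℝ => amplitude Ψ X z p := by
    simp only [amplitude, mulVec, dotProduct]; fun_prop
  have h := lintegral_amplitude (Ψ := Ψ) hX p (f := fun x => ENNReal.ofReal x) (by fun_prop)
  simp only [h0, zero_mul, ENNReal.ofReal_zero, lintegral_zero] at h
  rw [lintegral_eq_zero_iff (by fun_prop)] at h
  filter_upwards [h] with z hz
  exact le_antisymm (ENNReal.ofReal_eq_zero.1 hz) (sq_nonneg _)

theorem measurable_amplitude {n m : ℕ} (Ψ : Matrix (Fin m) (Fin n) ℝ)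
    (X : Matrix (Fin n) (Fin n) ℝ) (p : Fin m) : Measurable fun z => amplitude Ψ X z p := by
  simp only [amplitude, mulVec, dotProduct]; fun_prop

theorem measure_amplitude_gt_le {n m : ℕ} {Ψ : Matrix (Fin m) (Fin n) ℝ}
    {X : Matrix (Fin n) (Fin n) ℝ} (hX : X ∈ occupations n) (p : Fin m) (τ : ℝ) :
    stdNormal n {z | 4 * coherence Ψ * τ < amplitude Ψ X z p ^ 2}
      ≤ ENNReal.ofReal (√2 * Real.exp (-τ)) := by
  have hS : MeasurableSet {y : ℝ | 4 * coherence Ψ * τ < y} := measurableSet_Ioi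
  have h := lintegral_amplitude (Ψ := Ψ) hX p
    (f := Set.indicator {y : ℝ | 4 * coherence Ψ * τ < y} 1) (measurable_one.indicator hS)
  have e1 : ∀ z, Set.indicator {y : ℝ | 4 * coherence Ψ * τ < y} (1 : ℝ → ℝ≥0∞)
      (amplitude Ψ X z p ^ 2)
      = Set.indicator {z | 4 * coherence Ψ * τ < amplitude Ψ X z p ^ 2} 1 z := fun z => rfl
  have e2 : ∀ x, Set.indicator {y : ℝ | 4 * coherence Ψ * τ < y} (1 : ℝ → ℝ≥0∞)
      (density Ψ X p * x ^ 2)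
      = Set.indicator {x : ℝ | 4 * coherence Ψ * τ < density Ψ X p * x ^ 2} 1 x := fun z => rfl
  simp_rw [e1, e2] at h
  have m1 : MeasurableSet {z | 4 * coherence Ψ * τ < amplitude Ψ X z p ^ 2} :=
    ((measurable_amplitude Ψ X p).pow_const 2) hS
  have m2 : MeasurableSet {x : ℝ | 4 * coherence Ψ * τ < density Ψ X p * x ^ 2} :=
    (by fun_prop : Measurable fun x : ℝ => density Ψ X p * x ^ 2) hS
  rw [lintegral_indicator_one m1, lintegral_indicator_one m2] at h
  rw [h]
  refine (measure_mono fun x hx => ?_).trans (gaussianReal_sq_gt_le τ)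
  have hx' : 4 * coherence Ψ * τ < density Ψ X p * x ^ 2 := hx
  have hd := density_mem_Icc (Ψ := Ψ) hX p
  have hc : 0 ≤ coherence Ψ := hd.1.trans hd.2
  change 4 * τ < x ^ 2
  by_contra! hcon
  have := mul_le_mul hd.2 hcon (sq_nonneg x) hc
  linarith

/-- Jensen for a subprobability: the missing mass is placed at 0, indexed by `none`. -/
theorem exp_sum_le_of_weights {ι : Type*} [Fintype ι] {w x : ι → ℝ} (hw : ∀ i, 0 ≤ w i)
    (hw1 : ∑ i, w i ≤ 1) :
    Real.exp (∑ i, w i * x i) ≤ ∑ i, w i * Real.exp (x i) + (1 - ∑ i, w i) := by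
  have h := convexOn_exp.map_sum_le (t := Finset.univ)
    (w := fun o : Option ι => o.elim (1 - ∑ i, w i) w) (p := fun o => o.elim 0 x)
    (by rintro (_ | i) _ <;> simp [hw, hw1]) (by simp [Fintype.sum_option]) (by simp)
  simp only [Fintype.sum_option, Option.elim_none, Option.elim_some, smul_eq_mul, mul_zero,
    zero_add, Real.exp_zero, mul_one] at h
  linarith

/-- Exponential moments of the gradient noise. -/
theorem lintegral_exp_gradNoise_le {n m : ℕ} {V : Matrix (Fin m) (Fin m) ℝ}
    {Ψ : Matrix (Fin m) (Fin n) ℝ} (hΨ : Ψᵀ * Ψ = 1) (hn : 0 < n)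
    {X X' : Matrix (Fin n) (Fin n) ℝ} (hX : X ∈ occupations n) (hX' : X' ∈ occupations n) {l : ℝ}
    (hl : 0 ≤ l) (hl' : l * n * cHartree V Ψ ≤ 1 / 4) :
    ∫⁻ z, ENNReal.ofReal (Real.exp (l * gradNoise V Ψ X' X z)) ∂(stdNormal n)
      ≤ ENNReal.ofReal (Real.exp (4 * (l * n * cHartree V Ψ) ^ 2)) := by
  have hn' : (0 : ℝ) < n := by exact_mod_cast hn
  set a : Fin m → ℝ := V *ᵥ density Ψ (X - X') with ha
  have hab : ∀ p, |a p| ≤ cHartree V Ψ := fun p => abs_mulVec_le V (abs_density_sub_le hX hX') p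
  -- The densities sum to Tr X ≤ n, so these are subprobability weights. The noise is then an
  -- average of normalized chi-square errors, and convexity of exp bounds its moment with no
  -- independence between different p and no dependence on m.
  set w : Fin m → ℝ := fun p => density Ψ X p / n with hw
  have hw0 : ∀ p, 0 ≤ w p := fun p => div_nonneg (density_mem_Icc hX p).1 hn'.le
  have hw1 : ∑ p, w p ≤ 1 := by
    rw [← Finset.sum_div, sum_density hΨ, div_le_one hn']; exact (trace_mem_Icc hX).2
  set θ : Fin m → ℝ := fun p => l * n * a p with hθ
  have hθb : ∀ p, |θ p| ≤ l * n * cHartree V Ψ := fun p => by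
    rw [hθ, abs_mul, abs_of_nonneg (by positivity : 0 ≤ l * n)]
    exact mul_le_mul_of_nonneg_left (hab p) (by positivity)
  set B := Real.exp (4 * (l * n * cHartree V Ψ) ^ 2) with hB
  have hae : ∀ᵐ z ∂(stdNormal n), ENNReal.ofReal (Real.exp (l * gradNoise V Ψ X' X z))
      ≤ ∑ p, ENNReal.ofReal (w p) * ENNReal.ofReal (Real.exp
        (θ p * (1 - amplitude Ψ X z p ^ 2 / density Ψ X p))) + ENNReal.ofReal (1 - ∑ p, w p) := by
    -- Where the density is 0 the quotient by it is meaningless; there the amplitude vanishes almost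
    -- surely, so the term drops out.
    have h0 : ∀ p, ∀ᵐ z ∂(stdNormal n), density Ψ X p = 0 → amplitude Ψ X z p ^ 2 = 0 := fun p => by
      by_cases h : density Ψ X p = 0
      · filter_upwards [amplitude_eq_zero hX h] with z hz _ using hz
      · exact ae_of_all _ fun z hz => absurd hz h
    filter_upwards [ae_all_iff.2 h0] with z hz
    have e : l * gradNoise V Ψ X' X z
        = ∑ p, w p * (θ p * (1 - amplitude Ψ X z p ^ 2 / density Ψ X p)) := by
      rw [gradNoise, Finset.mul_sum]
      refine Finset.sum_congr rfl fun p _ => ?_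
      by_cases h : density Ψ X p = 0
      · simp [hw, h, hz p h]
      · simp only [hw, hθ, ha]; field_simp
    rw [e]
    refine (ENNReal.ofReal_le_ofReal (exp_sum_le_of_weights hw0 hw1)).trans_eq ?_
    rw [ENNReal.ofReal_add (Finset.sum_nonneg fun p _ => mul_nonneg (hw0 p) (Real.exp_pos _).le)
      (by linarith), ENNReal.ofReal_sum_of_nonneg fun p _ => mul_nonneg (hw0 p) (Real.exp_pos _).le]
    simp_rw [ENNReal.ofReal_mul (hw0 _)]
  have hterm : ∀ p, ∫⁻ z, ENNReal.ofReal (Real.exp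
      (θ p * (1 - amplitude Ψ X z p ^ 2 / density Ψ X p))) ∂(stdNormal n) ≤ ENNReal.ofReal B ∨
      w p = 0 := by
    intro p
    by_cases h : density Ψ X p = 0
    · exact Or.inr (by simp [hw, h])
    · left
      rw [lintegral_amplitude hX p
        (f := fun y => ENNReal.ofReal (Real.exp (θ p * (1 - y / density Ψ X p)))) (by fun_prop)]
      simp_rw [mul_div_cancel_left₀ _ h]
      refine (lintegral_exp_mul_one_sub_sq_le ((hθb p).trans hl')).trans
        (ENNReal.ofReal_le_ofReal (Real.exp_le_exp.2 ?_))
      rw [← sq_abs (θ p)]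
      exact mul_le_mul_of_nonneg_left (pow_le_pow_left₀ (abs_nonneg _) (hθb p) 2) (by norm_num)
  have hB1 : 1 ≤ B := Real.one_le_exp (by positivity)
  have hmeas : ∀ p, Measurable fun z => ENNReal.ofReal (Real.exp
      (θ p * (1 - amplitude Ψ X z p ^ 2 / density Ψ X p))) := fun p => by
    have := measurable_amplitude Ψ X p
    fun_prop
  refine (lintegral_mono_ae hae).trans ?_
  rw [lintegral_add_right _ measurable_const, lintegral_finsetSum _ fun p _ =>
    (hmeas p).const_mul _, lintegral_const, measure_univ, mul_one]
  have hsum : ∑ p, ∫⁻ z, ENNReal.ofReal (w p) * ENNReal.ofReal (Real.exp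
      (θ p * (1 - amplitude Ψ X z p ^ 2 / density Ψ X p))) ∂(stdNormal n)
      ≤ ∑ p, ENNReal.ofReal (w p) * ENNReal.ofReal B := by
    refine Finset.sum_le_sum fun p _ => ?_
    rw [lintegral_const_mul _ (hmeas p)]
    rcases hterm p with h | h
    · gcongr
    · simp [h]
  refine (add_le_add_left hsum _).trans ?_
  rw [← Finset.sum_mul, ← ENNReal.ofReal_sum_of_nonneg fun p _ => hw0 p,
    ← ENNReal.ofReal_mul (Finset.sum_nonneg fun p _ => hw0 p),
    ← ENNReal.ofReal_add (mul_nonneg (Finset.sum_nonneg fun p _ => hw0 p) (by positivity))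
      (by linarith)]
  refine ENNReal.ofReal_le_ofReal ?_
  nlinarith

/-! ### Stochastic recursions driven by independent noise -/

section

variable {S Z : Type*}

theorem stateSeq_succ (step : S → Z → S) (y : S) (z : ℕ → Z) (t : ℕ) :
    stateSeq step y z (t + 1) = stateSeq step (step y (z 0)) (fun s => z (s + 1)) t := by
  induction t with
  | zero => rfl
  | succ t ih => rw [stateSeq, ih]; rfl

theorem stateSeq_congr (step : S → Z → S) (y : S) {z z' : ℕ → Z} {t : ℕ}
    (h : ∀ s < t, z s = z' s) : stateSeq step y z t = stateSeq step y z' t := by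
  induction t with
  | zero => rfl
  | succ t ih =>
    rw [stateSeq, stateSeq, ih fun s hs => h s (hs.trans t.lt_succ_self), h t t.lt_succ_self]

/-- Extension of a finite sequence by zero. -/
def extendZero [Zero Z] {T : ℕ} (w : Fin T → Z) (t : ℕ) : Z := if h : t < T then w ⟨t, h⟩ else 0

theorem extendZero_zero [Zero Z] {T : ℕ} (w : Fin (T + 1) → Z) : extendZero w 0 = w 0 := by
  simp [extendZero]

theorem extendZero_succ [Zero Z] {T : ℕ} (w : Fin (T + 1) → Z) (t : ℕ) :
    extendZero w (t + 1) = extendZero (fun j => w j.succ) t := by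
  simp [extendZero, Fin.succ]

variable [MeasurableSpace S] [MeasurableSpace Z]

theorem measurable_extendZero [Zero Z] {T : ℕ} (t : ℕ) :
    Measurable fun w : Fin T → Z => extendZero w t := by
  unfold extendZero
  split_ifs
  · exact measurable_pi_apply _
  · exact measurable_const

theorem measurable_stateSeq {A : Type*} [MeasurableSpace A] {step : S → Z → S}
    (hstep : Measurable (Function.uncurry step)) {y : A → S} (hy : Measurable y) {z : A → ℕ → Z}
    (hz : ∀ t, Measurable fun a => z a t) (t : ℕ) :
    Measurable fun a => stateSeq step (y a) (z a) t := by
  induction t with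
  | zero => exact hy
  | succ t ih => exact hstep.comp (ih.prodMk (hz t))

/-- If every factor has conditional mean at most `a t`, then the product along the recursion has
mean at most the product of the `a t`. -/
theorem lintegral_prod_stateSeq_le [Zero Z] {step : S → Z → S}
    (hstep : Measurable (Function.uncurry step)) (ν : Measure Z) [IsProbabilityMeasure ν] (T : ℕ)
    {M : ℕ → S → Z → ℝ≥0∞} (hM : ∀ t, Measurable (Function.uncurry (M t))) {a : ℕ → ℝ≥0∞}
    (ha : ∀ t y, ∫⁻ z, M t y z ∂ν ≤ a t) (y : S) :
    ∫⁻ w, ∏ t ∈ Finset.range T, M t (stateSeq step y (extendZero w) t) (extendZero w t)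
      ∂(Measure.pi fun _ : Fin T => ν) ≤ ∏ t ∈ Finset.range T, a t := by
  induction T generalizing M a y with
  | zero => simp
  | succ T ih =>
    -- The first noise vector is split off and the remaining product is a run from the state it
    -- produces. The inductive bound is uniform in that state, so no filtration or conditional
    -- expectation is needed.
    set G : Z × (Fin T → Z) → ℝ≥0∞ := fun q => M 0 y q.1 * ∏ t ∈ Finset.range T,
      M (t + 1) (stateSeq step (step y q.1) (extendZero q.2) t) (extendZero q.2 t) with hG
    have hstep1 : Measurable fun q : Z × (Fin T → Z) => step y q.1 :=
      hstep.comp (measurable_const.prodMk measurable_fst)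
    have hGm : Measurable G := by
      refine ((hM 0).comp (measurable_const.prodMk measurable_fst)).mul ?_
      refine Finset.measurable_prod _ fun t _ => (hM (t + 1)).comp
        ((measurable_stateSeq hstep hstep1 (fun s => ?_) t).prodMk ?_)
      · exact (measurable_extendZero s).comp measurable_snd
      · exact (measurable_extendZero t).comp measurable_snd
    have hmp := measurePreserving_piFinSuccAbove (fun _ : Fin (T + 1) => ν) 0
    have e : ∀ w : Fin (T + 1) → Z, ∏ t ∈ Finset.range (T + 1),
        M t (stateSeq step y (extendZero w) t) (extendZero w t)
        = G (MeasurableEquiv.piFinSuccAbove (fun _ => Z) 0 w) := by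
      intro w
      rw [Finset.prod_range_succ', mul_comm]
      have h2 : MeasurableEquiv.piFinSuccAbove (fun _ => Z) 0 w = (w 0, fun j => w j.succ) := rfl
      simp only [hG, h2, stateSeq_succ, extendZero_zero, extendZero_succ]
      rfl
    simp_rw [e]
    rw [hmp.lintegral_comp hGm, lintegral_prod _ hGm.aemeasurable, Finset.prod_range_succ',
      mul_comm]
    calc _ ≤ ∫⁻ z, M 0 y z * ∏ t ∈ Finset.range T, a (t + 1) ∂ν := by
          refine lintegral_mono fun z => ?_
          simp only [hG]
          rw [lintegral_const_mul]
          · exact mul_le_mul_right (ih (fun t => hM (t + 1)) (fun t => ha (t + 1)) (step y z)) _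
          · refine Finset.measurable_prod _ fun t _ => (hM (t + 1)).comp
              ((measurable_stateSeq hstep measurable_const (fun s => ?_) t).prodMk ?_)
            · exact measurable_extendZero s
            · exact measurable_extendZero t
      _ = (∫⁻ z, M 0 y z ∂ν) * ∏ t ∈ Finset.range T, a (t + 1) :=
          lintegral_mul_const _ ((hM 0).comp (measurable_const.prodMk measurable_id))
      _ ≤ _ := mul_le_mul_left (ha 0 y) _

/-- Union bound along the recursion. -/
theorem measure_exists_stateSeq_le [Zero Z] {step : S → Z → S}
    (hstep : Measurable (Function.uncurry step)) (ν : Measure Z) [IsProbabilityMeasure ν] (T : ℕ)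
    {B : Set (S × Z)} (hB : MeasurableSet B) {a : ℝ≥0∞} (ha : ∀ y, ν {z | (y, z) ∈ B} ≤ a) (y : S) :
    (Measure.pi fun _ : Fin T => ν)
      {w | ∃ t < T, (stateSeq step y (extendZero w) t, extendZero w t) ∈ B} ≤ T * a := by
  have key : ∀ t < T, (Measure.pi fun _ : Fin T => ν)
      {w | (stateSeq step y (extendZero w) t, extendZero w t) ∈ B} ≤ a := by
    intro t ht
    have hm : MeasurableSet {w : Fin T → Z |
        (stateSeq step y (extendZero w) t, extendZero w t) ∈ B} :=
      ((measurable_stateSeq hstep measurable_const (fun s => measurable_extendZero s) t).prodMk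
        (measurable_extendZero t)) hB
    -- With the indicator as the factor at time t and 1 at all other times, the product bound
    -- becomes a bound on one event.
    have h := lintegral_prod_stateSeq_le hstep ν T
      (M := fun s y z => if s = t then B.indicator 1 (y, z) else 1)
      (a := fun s => if s = t then a else 1)
      (fun s => by
        by_cases hs : s = t
        · simp only [hs, if_true]; exact measurable_one.indicator hB
        · simp only [hs, if_false]; exact measurable_const)
      (fun s y => by
        by_cases hs : s = t
        · simp only [hs, if_true]
          refine le_trans (le_of_eq ?_) (ha y)
          have hm2 : MeasurableSet {z | (y, z) ∈ B} := measurable_prodMk_left hB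
          rw [← lintegral_indicator_one hm2]
          rfl
        · simp [hs]) y
    simp only [Finset.prod_ite_eq', Finset.mem_range, ht, if_true] at h
    rw [← lintegral_indicator_one hm]
    exact h
  have hsub : {w : Fin T → Z | ∃ t < T, (stateSeq step y (extendZero w) t, extendZero w t) ∈ B}
      ⊆ ⋃ t ∈ Finset.range T, {w | (stateSeq step y (extendZero w) t, extendZero w t) ∈ B} := by
    rintro w ⟨t, ht, hw⟩
    exact Set.mem_biUnion (Finset.mem_coe.2 (Finset.mem_range.2 ht)) hw
  refine (measure_mono hsub).trans ((measure_biUnion_finset_le _ _).trans ?_)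
  refine (Finset.sum_le_sum fun t ht => key t (Finset.mem_range.1 ht)).trans_eq ?_
  simp

end

/-! ### Measurability of the mirror descent step -/

/-- The space of symmetric matrices. -/
def SymMatrix (n : ℕ) : Type := {A : Matrix (Fin n) (Fin n) ℝ // A.IsHermitian}

namespace SymMatrix

variable {n m : ℕ}

instance : TopologicalSpace (SymMatrix n) :=
  inferInstanceAs (TopologicalSpace {A : Matrix (Fin n) (Fin n) ℝ // A.IsHermitian})

instance : MeasurableSpace (SymMatrix n) := borel _

instance : BorelSpace (SymMatrix n) := ⟨rfl⟩

theorem continuous_val : Continuous fun Y : SymMatrix n => Y.1 := continuous_subtype_val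

/-- This is why the state space is the symmetric matrices: elsewhere `cfc` is the default value 0
and continuity fails to be available. -/
theorem continuous_cfc {f : ℝ → ℝ} (hf : Continuous f) :
    Continuous fun Y : SymMatrix n => cfc f Y.1 :=
  continuousOn_iff_continuous_domRestrict.1 (continuousOn_cfc_isHermitian hf)

theorem continuous_sigmoid : Continuous fun y : ℝ => (1 + Real.exp (-y))⁻¹ :=
  (by fun_prop : Continuous fun y : ℝ => 1 + Real.exp (-y)).inv₀ fun y => by positivity

theorem continuous_invMirrorMap : Continuous fun Y : SymMatrix n => invMirrorMap Y.1 :=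
  continuous_cfc continuous_sigmoid

theorem continuous_sqrt_mulVec : Continuous fun q : SymMatrix n × (Fin n → ℝ) =>
    cfc Real.sqrt (invMirrorMap q.1.1) *ᵥ q.2 := by
  have h : ∀ Y : SymMatrix n, cfc Real.sqrt (invMirrorMap Y.1)
      = cfc (fun y : ℝ => √((1 + Real.exp (-y))⁻¹)) Y.1 := fun Y => cfc_cfc Y.2 _ _
  simp_rw [h]
  exact ((continuous_cfc (Real.continuous_sqrt.comp continuous_sigmoid)).comp
    continuous_fst).matrix_mulVec continuous_snd

theorem continuous_density (Ψ : Matrix (Fin m) (Fin n) ℝ) : Continuous (density Ψ) := by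
  refine continuous_pi fun p => ?_
  simp only [density]
  exact ((continuous_const.matrix_mul continuous_id).matrix_mul continuous_const).matrix_elem p p

theorem continuous_hartreeGrad (V : Matrix (Fin m) (Fin m) ℝ) (Ψ : Matrix (Fin m) (Fin n) ℝ) :
    Continuous (hartreeGrad V Ψ) := by
  have h : hartreeGrad V Ψ = fun X => Ψᵀ * diagonal (V *ᵥ density Ψ X) * Ψ :=
    funext (hartreeGrad_eq V Ψ)
  rw [h]
  exact (continuous_const.matrix_mul
    (continuous_const.matrix_mulVec (continuous_density Ψ)).matrix_diagonal).matrix_mul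
    continuous_const

/-- The dual mirror descent step on symmetric matrices. -/
noncomputable def step {C : Matrix (Fin n) (Fin n) ℝ} (hC : C.IsHermitian)
    (V : Matrix (Fin m) (Fin m) ℝ) (Ψ : Matrix (Fin m) (Fin n) ℝ) (b μ s : ℝ)
    (Y : SymMatrix n) (z : Fin n → ℝ) : SymMatrix n :=
  ⟨dualStep C V Ψ b μ s Y.1 z, isHermitian_dualStep hC Y.2 z⟩

/-- The initial dual state. -/
def init (n : ℕ) : SymMatrix n := ⟨0, isHermitian_zero⟩

variable {C : Matrix (Fin n) (Fin n) ℝ} (hC : C.IsHermitian)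
    (V : Matrix (Fin m) (Fin m) ℝ) (Ψ : Matrix (Fin m) (Fin n) ℝ) (b μ s : ℝ)

theorem measurable_step : Measurable (Function.uncurry (step hC V Ψ b μ s)) := by
  have hY : Continuous fun q : SymMatrix n × (Fin n → ℝ) => q.1.1 :=
    continuous_val.comp continuous_fst
  have hG : Continuous fun q : SymMatrix n × (Fin n → ℝ) =>
      gradEst C V Ψ (invMirrorMap q.1.1) q.2 :=
    continuous_const.add ((continuous_hartreeGrad V Ψ).comp
      (continuous_sqrt_mulVec.matrix_vecMulVec continuous_sqrt_mulVec))
  have h : Continuous fun q : SymMatrix n × (Fin n → ℝ) => dualStep C V Ψ b μ s q.1.1 q.2 := by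
    have := (hY.const_smul (1 - b * s)).sub
      ((hG.sub (continuous_const (y := μ • (1 : Matrix (Fin n) (Fin n) ℝ)))).const_smul s)
    exact this
  have h' : Continuous (Function.uncurry (step hC V Ψ b μ s)) := h.subtype_mk _
  exact h'.measurable

theorem stateSeq_step_val (z : ℕ → Fin n → ℝ) (t : ℕ) :
    (stateSeq (step hC V Ψ b μ s) (init n) z t).1 = stateSeq (dualStep C V Ψ b μ s) 0 z t := by
  induction t with
  | zero => rfl
  | succ t ih =>
    change dualStep C V Ψ b μ s (stateSeq (step hC V Ψ b μ s) (init n) z t).1 (z t) = _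
    rw [ih]; rfl

theorem measurable_amplitude_prod (p : Fin m) : Measurable fun q : SymMatrix n × (Fin n → ℝ) =>
    amplitude Ψ (invMirrorMap q.1.1) q.2 p :=
  ((continuous_apply p).comp
    (continuous_const.matrix_mulVec continuous_sqrt_mulVec)).measurable

theorem measurable_gradNoise (X : Matrix (Fin n) (Fin n) ℝ) :
    Measurable fun q : SymMatrix n × (Fin n → ℝ) => gradNoise V Ψ X (invMirrorMap q.1.1) q.2 := by
  have hX : Continuous fun q : SymMatrix n × (Fin n → ℝ) => invMirrorMap q.1.1 :=
    continuous_invMirrorMap.comp continuous_fst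
  refine Finset.measurable_sum _ fun p _ => Measurable.mul ?_ (Measurable.sub ?_
    ((measurable_amplitude_prod Ψ p).pow_const 2))
  · exact ((continuous_apply p).comp (continuous_const.matrix_mulVec
      ((continuous_density Ψ).comp (hX.sub continuous_const)))).measurable
  · exact ((continuous_apply p).comp ((continuous_density Ψ).comp hX)).measurable

theorem measurable_gradNoise_stateSeq (X : Matrix (Fin n) (Fin n) ℝ) {T : ℕ} (t : ℕ) :
    Measurable fun w : Fin T → Fin n → ℝ => gradNoise V Ψ X
      (invMirrorMap (stateSeq (step hC V Ψ b μ s) (init n) (extendZero w) t).1)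
      (extendZero w t) := by
  have hst : Measurable fun w : Fin T → Fin n → ℝ =>
      stateSeq (step hC V Ψ b μ s) (init n) (extendZero w) t :=
    measurable_stateSeq (y := fun _ : Fin T → Fin n → ℝ => init n)
      (z := fun w => extendZero w) (measurable_step hC V Ψ b μ s) measurable_const
      (fun t => measurable_extendZero t) t
  have hpair : Measurable fun w : Fin T → Fin n → ℝ =>
      (stateSeq (step hC V Ψ b μ s) (init n) (extendZero w) t, extendZero w t) :=
    hst.prodMk (measurable_extendZero t)
  have h := Measurable.comp (g := fun q : SymMatrix n × (Fin n → ℝ) =>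
    gradNoise V Ψ X (invMirrorMap q.1.1) q.2) (measurable_gradNoise V Ψ X) hpair
  simp only [Function.comp_def] at h
  exact h

end SymMatrix

/-! ### Concentration along the trajectory -/

section

variable {n m : ℕ} {C : Matrix (Fin n) (Fin n) ℝ} {V : Matrix (Fin m) (Fin m) ℝ}
  {Ψ : Matrix (Fin m) (Fin n) ℝ}

theorem measure_amplitude_large_le (hC : C.IsHermitian) (b μ s : ℝ) (T : ℕ) (L : ℝ) :
    (Measure.pi fun _ : Fin T => stdNormal n) {w | ∃ t < T, ∃ p, 8 * coherence Ψ * L <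
      amplitude Ψ (invMirrorMap (stateSeq (dualStep C V Ψ b μ s) 0 (extendZero w) t))
        (extendZero w t) p ^ 2} ≤ ENNReal.ofReal (T * (m * (√2 * Real.exp (-(2 * L))))) := by
  have h := measure_exists_stateSeq_le (SymMatrix.measurable_step hC V Ψ b μ s) (stdNormal n) T
    (B := ⋃ p, {q : SymMatrix n × (Fin n → ℝ) |
      8 * coherence Ψ * L < amplitude Ψ (invMirrorMap q.1.1) q.2 p ^ 2})
    (MeasurableSet.iUnion fun p =>
      measurableSet_lt measurable_const ((SymMatrix.measurable_amplitude_prod Ψ p).pow_const 2))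
    (a := m * ENNReal.ofReal (√2 * Real.exp (-(2 * L)))) (fun Y => by
      have e : {z | (Y, z) ∈ ⋃ p, {q : SymMatrix n × (Fin n → ℝ) |
          8 * coherence Ψ * L < amplitude Ψ (invMirrorMap q.1.1) q.2 p ^ 2}}
          = ⋃ p, {z | 4 * coherence Ψ * (2 * L) < amplitude Ψ (invMirrorMap Y.1) z p ^ 2} := by
        ext z
        simp only [Set.mem_iUnion, Set.mem_ofPred_eq]
        rw [show 4 * coherence Ψ * (2 * L) = 8 * coherence Ψ * L by ring]
      rw [e]
      refine (measure_iUnion_fintype_le _ _).trans ((Finset.sum_le_sum fun p _ =>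
        measure_amplitude_gt_le (invMirrorMap_mem_occupations Y.2) p (2 * L)).trans_eq ?_)
      simp) (SymMatrix.init n)
  have e1 : ENNReal.ofReal (T * (m * (√2 * Real.exp (-(2 * L)))))
      = T * (m * ENNReal.ofReal (√2 * Real.exp (-(2 * L)))) := by
    rw [ENNReal.ofReal_mul (by positivity), ENNReal.ofReal_mul (by positivity),
      ENNReal.ofReal_natCast, ENNReal.ofReal_natCast]
  rw [e1]
  refine le_trans (le_of_eq ?_) h
  congr 1
  ext w
  simp only [Set.mem_ofPred_eq, Set.mem_iUnion, SymMatrix.stateSeq_step_val]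

theorem measure_sum_gradNoise_large_le (hC : C.IsHermitian) (hΨ : Ψᵀ * Ψ = 1) (hn : 0 < n)
    (hV0 : V ≠ 0) (b μ s : ℝ) {T : ℕ} (hT : 1 ≤ T) (L : ℝ) {X : Matrix (Fin n) (Fin n) ℝ}
    (hX : X ∈ occupations n) :
    (Measure.pi fun _ : Fin T => stdNormal n) {w | 4 * n * cHartree V Ψ * √(T : ℝ) * (1 / 4 + L) <
      ∑ t ∈ Finset.range T, gradNoise V Ψ X
        (invMirrorMap (stateSeq (dualStep C V Ψ b μ s) 0 (extendZero w) t)) (extendZero w t)}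
      ≤ ENNReal.ofReal (Real.exp (-L)) := by
  have hn' : (0 : ℝ) < n := by exact_mod_cast hn
  have hT' : (1 : ℝ) ≤ T := by exact_mod_cast hT
  have hsT : 1 ≤ √(T : ℝ) := Real.one_le_sqrt.2 hT'
  have hc := cHartree_pos hΨ hn hV0
  set c := cHartree V Ψ with hcdef
  -- With this l, l n c = 1/(4√T) ≤ 1/4, so the one-step bound applies and the T factors multiply to
  -- exp(1/4); Markov at level exp(1/4 + L) leaves exp(-L).
  set l := 1 / (4 * n * c * √(T : ℝ)) with hl
  have hl0 : 0 < l := by positivity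
  have hlc : l * n * c = 1 / (4 * √(T : ℝ)) := by rw [hl]; field_simp
  have hl4 : l * n * c ≤ 1 / 4 := by
    rw [hlc]; exact one_div_le_one_div_of_le (by norm_num) (by linarith)
  have h := lintegral_prod_stateSeq_le (SymMatrix.measurable_step hC V Ψ b μ s) (stdNormal n) T
    (M := fun _ Y z => ENNReal.ofReal (Real.exp (l * gradNoise V Ψ X (invMirrorMap Y.1) z)))
    (fun _ => ENNReal.measurable_ofReal.comp (Real.measurable_exp.comp
      ((SymMatrix.measurable_gradNoise V Ψ X).const_mul l)))
    (a := fun _ => ENNReal.ofReal (Real.exp (4 * (l * n * c) ^ 2)))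
    (fun _ Y => lintegral_exp_gradNoise_le hΨ hn (invMirrorMap_mem_occupations Y.2) hX hl0.le hl4)
    (SymMatrix.init n)
  simp only [SymMatrix.stateSeq_step_val] at h
  set R : (Fin T → Fin n → ℝ) → ℝ := fun w => ∑ t ∈ Finset.range T, gradNoise V Ψ X
        (invMirrorMap (stateSeq (dualStep C V Ψ b μ s) 0 (extendZero w) t)) (extendZero w t)
    with hR
  have e : ∀ w : Fin T → Fin n → ℝ, ∏ t ∈ Finset.range T, ENNReal.ofReal (Real.exp (l *
      gradNoise V Ψ X (invMirrorMap (stateSeq (dualStep C V Ψ b μ s) 0 (extendZero w) t))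
        (extendZero w t))) = ENNReal.ofReal (Real.exp (l * R w)) := by
    intro w
    rw [← ENNReal.ofReal_prod_of_nonneg fun _ _ => (Real.exp_pos _).le, ← Real.exp_sum,
      ← Finset.mul_sum]
  have e2 : ∏ _t ∈ Finset.range T, ENNReal.ofReal (Real.exp (4 * (l * n * c) ^ 2))
      = ENNReal.ofReal (Real.exp (1 / 4)) := by
    rw [← ENNReal.ofReal_prod_of_nonneg fun _ _ => (Real.exp_pos _).le, ← Real.exp_sum, hlc]
    congr 2
    rw [Finset.sum_const, Finset.card_range, nsmul_eq_mul, div_pow, mul_pow, Real.sq_sqrt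
      (by linarith)]
    field_simp
  simp_rw [e] at h
  rw [e2] at h
  have hmeas : Measurable fun w => ENNReal.ofReal (Real.exp (l * R w)) := by
    refine ENNReal.measurable_ofReal.comp (Real.measurable_exp.comp (Measurable.const_mul ?_ l))
    simp only [hR, ← SymMatrix.stateSeq_step_val hC]
    exact Finset.measurable_sum _ fun t _ => SymMatrix.measurable_gradNoise_stateSeq hC V Ψ b μ s X t
  have hmk := (mul_meas_ge_le_lintegral (μ := Measure.pi fun _ : Fin T => stdNormal n) hmeas
    (ENNReal.ofReal (Real.exp (1 / 4 + L)))).trans h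
  have hsub : {w | 4 * n * c * √(T : ℝ) * (1 / 4 + L) < R w} ⊆
      {w | ENNReal.ofReal (Real.exp (1 / 4 + L)) ≤ ENNReal.ofReal (Real.exp (l * R w))} := by
    intro w hw
    refine ENNReal.ofReal_le_ofReal (Real.exp_le_exp.2 ?_)
    have hw' : 4 * n * c * √(T : ℝ) * (1 / 4 + L) < R w := hw
    have := mul_le_mul_of_nonneg_left hw'.le hl0.le
    have e3 : l * (4 * n * c * √(T : ℝ) * (1 / 4 + L)) = 1 / 4 + L := by
      rw [hl]; field_simp
    linarith
  have h3 := (mul_le_mul_right (measure_mono (μ := Measure.pi fun _ : Fin T => stdNormal n) hsub)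
    (ENNReal.ofReal (Real.exp (1 / 4 + L)))).trans hmk
  have e4 : ∀ x : ℝ≥0∞, x = ENNReal.ofReal (Real.exp (-(1 / 4 + L))) *
      (ENNReal.ofReal (Real.exp (1 / 4 + L)) * x) := fun x => by
    rw [← mul_assoc, ← ENNReal.ofReal_mul (Real.exp_pos _).le, ← Real.exp_add]
    simp
  rw [e4 ((Measure.pi fun _ : Fin T => stdNormal n) _)]
  refine (mul_le_mul_right h3 _).trans_eq ?_
  rw [← ENNReal.ofReal_mul (Real.exp_pos _).le, ← Real.exp_add]
  congr 2; ring

end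

/-! ### The chemical potential search -/

section

variable {n m : ℕ} {C : Matrix (Fin n) (Fin n) ℝ} {V : Matrix (Fin m) (Fin m) ℝ}
  {Ψ : Matrix (Fin m) (Fin n) ℝ} {β : ℝ≥0∞} {N : ℝ}

/-- The event on which a run of length `T` with comparison point `X` is controlled at confidence
level `L`. -/
def RunGood (C : Matrix (Fin n) (Fin n) ℝ) (V : Matrix (Fin m) (Fin m) ℝ)
    (Ψ : Matrix (Fin m) (Fin n) ℝ) (β : ℝ≥0∞) (μ s : ℝ) (T : ℕ) (L : ℝ)
    (X : Matrix (Fin n) (Fin n) ℝ) (z : ℕ → Fin n → ℝ) : Prop :=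
  (∀ t < T, ∀ p, amplitude Ψ (HartreeMD.iterate C V Ψ β μ s z t) (z t) p ^ 2
    ≤ 8 * coherence Ψ * L) ∧
  ∑ t ∈ Finset.range T, gradNoise V Ψ X (HartreeMD.iterate C V Ψ β μ s z t) (z t)
    ≤ 4 * n * cHartree V Ψ * √(T : ℝ) * (1 / 4 + L)

theorem log_two_le_log_confidence {T m : ℕ} (hT : 1 ≤ T) (hm : 1 ≤ m) {δ : ℝ} (hδ : 0 < δ)
    (hδ1 : δ ≤ 1) : Real.log 2 ≤ Real.log (2 * T * m / δ) := by
  have hT' : (1 : ℝ) ≤ T := by exact_mod_cast hT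
  have hm' : (1 : ℝ) ≤ m := by exact_mod_cast hm
  refine Real.log_le_log two_pos ?_
  rw [le_div_iff₀ hδ]
  nlinarith [one_le_mul_of_one_le_of_one_le hT' hm']

theorem measure_not_runGood_le (hC : C.IsHermitian) (hΨ : Ψᵀ * Ψ = 1) (hn : 0 < n) (hm : 1 ≤ m)
    (hV0 : V ≠ 0) (β : ℝ≥0∞) (μ s : ℝ) {T : ℕ} (hT : 1 ≤ T) {δ : ℝ} (hδ : 0 < δ) (hδ1 : δ ≤ 1)
    {X : Matrix (Fin n) (Fin n) ℝ} (hX : X ∈ occupations n)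
    {Ω : Type*} [MeasurableSpace Ω] (P : Measure Ω) [IsProbabilityMeasure P]
    {z : ℕ → Ω → Fin n → ℝ} (hz : ∀ t < T, HasLaw (z t) (stdNormal n) P)
    (hind : iIndepFun (fun t : Fin T => z t) P) :
    P {ω | ¬ RunGood C V Ψ β μ s T (Real.log (2 * T * m / δ)) X (fun t => z t ω)}
      ≤ ENNReal.ofReal δ := by
  have hT' : (1 : ℝ) ≤ T := by exact_mod_cast hT
  have hm' : (1 : ℝ) ≤ m := by exact_mod_cast hm
  have hTm := one_le_mul_of_one_le_of_one_le hT' hm'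
  set L := Real.log (2 * T * m / δ) with hL
  set W : Ω → Fin T → Fin n → ℝ := fun ω t => z t ω with hW
  have hWm : AEMeasurable W P := aemeasurable_pi_lambda _ fun t => (hz t t.2).aemeasurable
  have hmap : P.map W = Measure.pi fun _ : Fin T => stdNormal n := by
    rw [hW, (iIndepFun_iff_map_fun_eq_pi_map fun t : Fin T => (hz t t.2).aemeasurable).1 hind]
    congr 1
    ext1 t
    exact (hz t t.2).map_eq
  have hext : ∀ ω, ∀ t < T, extendZero (W ω) t = z t ω := fun ω t ht => by
    simp [extendZero, ht, hW]
  have hit : ∀ ω, ∀ t < T, invMirrorMap (stateSeq (dualStep C V Ψ (betaInv β) μ s) 0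
      (extendZero (W ω)) t) = HartreeMD.iterate C V Ψ β μ s (fun t => z t ω) t := fun ω t ht => by
    rw [iterate_eq hC, stateSeq_congr _ _ fun r hr => hext ω r (hr.trans ht)]
  have hsub : {ω | ¬ RunGood C V Ψ β μ s T L X (fun t => z t ω)} ⊆
      W ⁻¹' {w | ∃ t < T, ∃ p, 8 * coherence Ψ * L <
        amplitude Ψ (invMirrorMap (stateSeq (dualStep C V Ψ (betaInv β) μ s) 0 (extendZero w) t))
        (extendZero w t) p ^ 2} ∪
      W ⁻¹' {w | 4 * n * cHartree V Ψ * √(T : ℝ) * (1 / 4 + L) <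
      ∑ t ∈ Finset.range T, gradNoise V Ψ X
        (invMirrorMap (stateSeq (dualStep C V Ψ (betaInv β) μ s) 0 (extendZero w) t))
        (extendZero w t)} := by
    intro ω hω
    by_contra hcon
    rw [Set.mem_union, not_or] at hcon
    obtain ⟨h1, h2⟩ := hcon
    refine hω ⟨fun t ht p => ?_, ?_⟩
    · by_contra! h
      refine h1 ⟨t, ht, p, ?_⟩
      rw [hit ω t ht, hext ω t ht]; exact h
    · refine le_trans (le_of_eq (Finset.sum_congr rfl fun t ht => ?_)) (not_lt.1 h2)
      have ht' := Finset.mem_range.1 ht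
      rw [hit ω t ht', hext ω t ht']
  refine (measure_mono hsub).trans ((measure_union_le _ _).trans ?_)
  -- The noise is only almost everywhere measurable and the bad sets need not be shown measurable:
  -- the measure of a preimage is at most the pushforward measure of any set.
  refine (add_le_add ((Measure.le_map_apply hWm _).trans
    ((congrArg (fun Q : Measure (Fin T → Fin n → ℝ) => Q _) hmap).le.trans
      (measure_amplitude_large_le hC (betaInv β) μ s T L)))
    ((Measure.le_map_apply hWm _).trans
    ((congrArg (fun Q : Measure (Fin T → Fin n → ℝ) => Q _) hmap).le.trans
      (measure_sum_gradNoise_large_le hC hΨ hn hV0 (betaInv β) μ s hT L hX)))).trans ?_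
  rw [← ENNReal.ofReal_add (by positivity) (by positivity)]
  refine ENNReal.ofReal_le_ofReal ?_
  have hq : Real.exp (-L) = δ / (2 * T * m) := by
    rw [Real.exp_neg, hL, Real.exp_log (by positivity), inv_div]
  -- The amplitude threshold uses 2L, not L: the second power of δ/(2Tm) absorbs both the union over
  -- t and p and the factor √2, leaving at most δ/2 for each event.
  have hq2 : Real.exp (-(2 * L)) = (δ / (2 * T * m)) ^ 2 := by
    rw [← hq, ← Real.exp_nat_mul]; congr 1; push_cast; ring
  rw [hq2, hq]
  have h2 : √(2 : ℝ) ≤ 2 := by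
    rw [Real.sqrt_le_left two_pos.le]; norm_num
  have hq1 : δ / (2 * T * m) ≤ δ / 2 := by
    refine div_le_div_of_nonneg_left hδ.le two_pos (by nlinarith)
  have e : T * (m * (√2 * (δ / (2 * T * m)) ^ 2)) = √2 * (δ / (2 * T * m)) * (δ / 2) := by
    field_simp
  rw [e]
  have hq0 : 0 ≤ δ / (2 * T * m) := by positivity
  have : √2 * (δ / (2 * T * m)) ≤ 2 * (1 / 2) := mul_le_mul h2 (by linarith) hq0 two_pos.le
  nlinarith

/-- The total scale `‖C‖ + c_h + β⁻¹ log(1/(γ(1-γ)))`. -/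
noncomputable def errorScale (C : Matrix (Fin n) (Fin n) ℝ) (V : Matrix (Fin m) (Fin m) ℝ)
    (Ψ : Matrix (Fin m) (Fin n) ℝ) (β : ℝ≥0∞) (N : ℝ) : ℝ :=
  specNorm C + cHartree V Ψ + betaInv β * Real.log (1 / (N / n * (1 - N / n)))

theorem log_filling_eq (hN : 0 < N) (hNn : N < n) :
    Real.log (1 / (N / n * (1 - N / n))) = Real.log ((N / n)⁻¹) + Real.log ((1 - N / n)⁻¹) := by
  have hn : (0 : ℝ) < n := hN.trans hNn
  have h1 : N / n < 1 := (div_lt_one hn).2 hNn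
  have h0 : 0 < N / n := by positivity
  rw [one_div, mul_inv, Real.log_mul (by positivity) (inv_ne_zero (by linarith))]

theorem mu_bounds (hC : C.IsHermitian) (hN : 0 < N) (hNn : N < n) (hc : 0 ≤ cHartree V Ψ) :
    -errorScale C V Ψ β N ≤ muLeft C V Ψ β N ∧ muLeft C V Ψ β N ≤ muRight C V Ψ β N ∧
      muRight C V Ψ β N ≤ errorScale C V Ψ β N := by
  have hn : 0 < n := by exact_mod_cast hN.trans hNn
  have h := log_filling_nonneg hN hNn
  have h1 := mul_nonneg (betaInv_nonneg β) h.1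
  have h2 := mul_nonneg (betaInv_nonneg β) h.2
  have h3 := eigMin_eigMax_bounds hC hn
  rw [errorScale, log_filling_eq hN hNn, mul_add, muLeft, muRight]
  refine ⟨?_, ?_, ?_⟩ <;> linarith

theorem muGrid_mem_Icc {K : ℕ} (hK : 1 ≤ K) (h : muLeft C V Ψ β N ≤ muRight C V Ψ β N)
    (k : Fin (K + 1)) :
    muGrid C V Ψ β N K k ∈ Set.Icc (muLeft C V Ψ β N) (muRight C V Ψ β N) := by
  have hK' : (0 : ℝ) < K := by exact_mod_cast hK
  have h1 : ((k : ℕ) : ℝ) / K ≤ 1 := by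
    rw [div_le_one hK']; exact_mod_cast Nat.lt_succ_iff.1 k.2
  have h0 : 0 ≤ ((k : ℕ) : ℝ) / K := by positivity
  have hd := sub_nonneg.2 h
  rw [muGrid]
  constructor <;> nlinarith

theorem exists_muGrid_near {K : ℕ} (hK : 1 ≤ K) (h : muLeft C V Ψ β N < muRight C V Ψ β N) {ν : ℝ}
    (hν : ν ∈ Set.Icc (muLeft C V Ψ β N) (muRight C V Ψ β N)) :
    ∃ k : Fin (K + 1), |muGrid C V Ψ β N K k - ν| ≤
      (muRight C V Ψ β N - muLeft C V Ψ β N) / K := by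
  have hK' : (0 : ℝ) < K := by exact_mod_cast hK
  have hd := sub_pos.2 h
  set D := muRight C V Ψ β N - muLeft C V Ψ β N with hD
  set x := (ν - muLeft C V Ψ β N) / D * K with hx
  have hx0 : 0 ≤ x := mul_nonneg (div_nonneg (sub_nonneg.2 hν.1) hd.le) hK'.le
  have hxK : x ≤ K := by
    refine mul_le_of_le_one_left hK'.le ((div_le_one hd).2 ?_)
    rw [hD]; linarith [hν.2]
  have hf1 := Nat.floor_le hx0
  have hf2 := (Nat.lt_floor_add_one x).le
  refine ⟨⟨⌊x⌋₊, Nat.lt_succ_iff.2 (Nat.floor_le_of_le hxK)⟩, ?_⟩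
  have e : muGrid C V Ψ β N K ⟨⌊x⌋₊, Nat.lt_succ_iff.2 (Nat.floor_le_of_le hxK)⟩ - ν
      = (⌊x⌋₊ - x) * (D / K) := by
    have hxD : x * (D / K) = ν - muLeft C V Ψ β N := by rw [hx]; field_simp
    rw [muGrid, ← hD, sub_mul, hxD]
    ring
  rw [e, abs_mul, abs_of_pos (div_pos hd hK')]
  refine mul_le_of_le_one_left (div_pos hd hK').le ?_
  rw [abs_le]; constructor <;> linarith

theorem dualEst_eq (K T : ℕ) (δ : ℝ) (k : Fin (K + 1)) (z : ℕ → Fin n → ℝ) :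
    dualEst C V Ψ β N K T δ k z =
      freeEnergy C V Ψ β (cesaro C V Ψ β (muGrid C V Ψ β N K k)
          (mirrorStep V Ψ β T (δ / (K + 1))) T z)
        - muGrid C V Ψ β N K k * ((cesaro C V Ψ β (muGrid C V Ψ β N K k)
          (mirrorStep V Ψ β T (δ / (K + 1))) T z).trace - N) := by
  simp only [dualEst]; ring

/-- For every noise realization: X̄ only has to be feasible. Changing the multiplier from ν to the
near grid point costs at most one mesh width times |Tr X̄ - N| ≤ n. -/
theorem optValue_sub_le_maxDualEst (hC : C.IsHermitian) (hV : V.PosSemidef) (hΨ : Ψᵀ * Ψ = 1)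
    (hV0 : V ≠ 0) (hN : 0 < N) (hNn : N < n) {K T : ℕ} (hK : 1 ≤ K) (hT : 1 ≤ T) (δ : ℝ)
    (z : Fin (K + 1) → ℕ → Fin n → ℝ) :
    optValue C V Ψ β N - maxDualEst C V Ψ β N K T δ z
      ≤ n * (2 * errorScale C V Ψ β N / K) := by
  have hn : 0 < n := by exact_mod_cast hN.trans hNn
  have hc := cHartree_pos hΨ hn hV0
  have hK' : (0 : ℝ) < K := by exact_mod_cast hK
  have hb := mu_bounds (β := β) hC hN hNn hc.le
  have hlt : muLeft C V Ψ β N < muRight C V Ψ β N := by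
    have h := log_filling_nonneg hN hNn
    have h1 := mul_nonneg (betaInv_nonneg β) h.1
    have h2 := mul_nonneg (betaInv_nonneg β) h.2
    have h3 := eigMin_eigMax_bounds hC hn
    rw [muLeft, muRight]; linarith
  obtain ⟨ν, hν, hdual⟩ := exists_chemicalPotential (β := β) hC hV hΨ hN hNn
  obtain ⟨k, hk⟩ := exists_muGrid_near hK hlt hν
  have hle : dualEst C V Ψ β N K T δ k (z k) ≤ maxDualEst C V Ψ β N K T δ z :=
    le_ciSup (f := fun k => dualEst C V Ψ β N K T δ k (z k)) (Set.finite_range _).bddAbove k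
  have hmem := cesaro_mem_occupations (V := V) (Ψ := Ψ) hC β (μ := muGrid C V Ψ β N K k)
    (s := mirrorStep V Ψ β T (δ / (K + 1))) (z k) hT
  have h1 := hdual _ hmem
  rw [dualEst_eq] at hle
  set X := cesaro C V Ψ β (muGrid C V Ψ β N K k) (mirrorStep V Ψ β T (δ / (K + 1))) T (z k)
  have htr := trace_mem_Icc hmem
  have h2 : |(muGrid C V Ψ β N K k - ν) * (X.trace - N)| ≤ (2 * errorScale C V Ψ β N / K) * n := by
    rw [abs_mul]
    refine mul_le_mul (hk.trans ?_) ?_ (abs_nonneg _) (div_nonneg ?_ hK'.le)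
    · gcongr; linarith
    · rw [abs_le]; constructor <;> linarith [htr.1, htr.2]
    · linarith
  have h3 := (abs_le.1 h2).2
  linarith

theorem dualEst_sub_le (hC : C.IsHermitian) (hV : V.PosSemidef) (hΨ : Ψᵀ * Ψ = 1)
    (hV0 : V ≠ 0) (hm : 1 ≤ m) (hN : 0 < N) (hNn : N < n) {K T : ℕ} (hK : 1 ≤ K) (hT : 1 ≤ T)
    {δ : ℝ} (hδ : 0 < δ) (hδ1 : δ ≤ 1) (k : Fin (K + 1)) {z : ℕ → Fin n → ℝ}
    {X : Matrix (Fin n) (Fin n) ℝ} (hX : X ∈ occupations n) (htr : X.trace = N)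
    (hgood : RunGood C V Ψ β (muGrid C V Ψ β N K k) (mirrorStep V Ψ β T (δ / (K + 1))) T
      (Real.log (2 * T * m / (δ / (K + 1)))) X z) :
    dualEst C V Ψ β N K T δ k z - freeEnergy C V Ψ β X ≤
      n * (19 * (cHartree V Ψ * Real.log (2 * T * m / (δ / (K + 1))) / √(T : ℝ))
        + 2 * errorScale C V Ψ β N / T) := by
  have hn' : (0 : ℝ) < n := hN.trans hNn
  have hn : 0 < n := by exact_mod_cast hn'
  have hT' : (0 : ℝ) < T := by exact_mod_cast hT
  have hc := cHartree_pos hΨ hn hV0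
  have hδK : 0 < δ / (K + 1) := by positivity
  have hδK1 : δ / (K + 1) ≤ 1 := by
    rw [div_le_one (by positivity)]
    have : (0 : ℝ) ≤ K := Nat.cast_nonneg K
    linarith
  have hL2 := log_two_le_log_confidence hT hm hδK hδK1
  set L := Real.log (2 * T * m / (δ / (K + 1))) with hL
  have hLhalf : 1 / 2 ≤ L := by linarith [Real.log_two_gt_d9]
  set μ := muGrid C V Ψ β N K k with hμ
  set c := cHartree V Ψ with hcdef
  have hsT : 0 < √(T : ℝ) := Real.sqrt_pos.2 hT'
  have hη : proxStep V Ψ T (δ / (K + 1)) = 1 / (2 * (1 + 4 * L) * c * √(T : ℝ)) := rfl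
  have hηpos : 0 < proxStep V Ψ T (δ / (K + 1)) := by rw [hη]; positivity
  have hmain := freeEnergy_cesaro_le (β := β) (μ := μ) hC hV hΨ hηpos hT hX hgood.1 hgood.2
  rw [dualEst_eq]
  have hstep : proxStep V Ψ T (δ / (K + 1)) / (1 + proxStep V Ψ T (δ / (K + 1)) * betaInv β)
    = mirrorStep V Ψ β T (δ / (K + 1)) := rfl
  rw [hstep, htr, mul_assoc (8 : ℝ), mul_assoc (8 : ℝ), mul_right_comm, ← cHartree_eq, ← hcdef]
    at hmain
  have hμabs : |μ| ≤ errorScale C V Ψ β N := by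
    have hb := mu_bounds (β := β) hC hN hNn hc.le
    have hg := muGrid_mem_Icc hK hb.2.1 k
    rw [abs_le]; constructor <;> linarith [hg.1, hg.2, hb.1, hb.2.2]
  have hCs : specNorm C ≤ errorScale C V Ψ β N := by
    have h := log_filling_nonneg hN hNn
    have h1 := mul_nonneg (betaInv_nonneg β) (add_nonneg h.1 h.2)
    rw [← log_filling_eq hN hNn] at h1
    rw [errorScale]; linarith
  have t1 : n * Real.log 2 / proxStep V Ψ T (δ / (K + 1)) / T
      = n * (2 * Real.log 2 * (1 + 4 * L) * (c / √(T : ℝ))) := by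
    rw [hη]; field_simp; rw [Real.sq_sqrt hT'.le]
  have t3 : T * (n * (proxStep V Ψ T (δ / (K + 1)) * (8 * (c * L)) ^ 2 / 8)) / T
      ≤ n * (L * (c / √(T : ℝ))) := by
    have e : T * (n * (proxStep V Ψ T (δ / (K + 1)) * (8 * (c * L)) ^ 2 / 8)) / T
        = n * ((4 * L / (1 + 4 * L)) * (L * (c / √(T : ℝ)))) := by
      rw [hη]; field_simp; ring
    rw [e]
    refine mul_le_mul_of_nonneg_left (mul_le_of_le_one_left (by positivity) ?_) hn'.le
    rw [div_le_one (by positivity)]; linarith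
  have t4 : 4 * n * c * √(T : ℝ) * (1 / 4 + L) / T = n * ((1 + 4 * L) * (c / √(T : ℝ))) := by
    field_simp; rw [Real.sq_sqrt hT'.le]
  have t2 : n * (specNorm C + |μ|) / T ≤ n * (2 * errorScale C V Ψ β N / T) := by
    rw [mul_div_assoc]; gcongr; linarith
  rw [add_div, add_div, add_div, t1, t4] at hmain
  have hx : 0 < c / √(T : ℝ) := by positivity
  -- With log 2 ≤ 1 the left side is at most 13L + 3 in units of c/√T, and L ≥ 1/2 turns 3 into 6L.
  have hfin : 2 * Real.log 2 * (1 + 4 * L) * (c / √(T : ℝ)) + L * (c / √(T : ℝ))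
      + (1 + 4 * L) * (c / √(T : ℝ)) ≤ 19 * (c * L / √(T : ℝ)) := by
    have h1 : Real.log 2 ≤ 1 := by linarith [Real.log_two_lt_d9]
    have e : 19 * (c * L / √(T : ℝ)) = (19 * L) * (c / √(T : ℝ)) := by ring
    rw [e, ← add_mul, ← add_mul]
    refine mul_le_mul_of_nonneg_right ?_ hx.le
    nlinarith
  have hfin' := mul_le_mul_of_nonneg_left hfin hn'.le
  rw [mul_add]
  linarith

/-- Since K + 1 ≤ 2K, the confidence logarithm is at most 2 log 2 + log Q with Q = KTm/δ. -/
theorem log_confidence_le {K T m : ℕ} (hK : 1 ≤ K) (hT : 1 ≤ T) (hm : 1 ≤ m) {δ : ℝ} (hδ : 0 < δ)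
    (hδ1 : δ ≤ 1) :
    Real.log (2 * T * m / (δ / (K + 1))) / √(T : ℝ)
      ≤ 3 * (Real.log (K * T * m / δ) / √(T : ℝ)) + 3 * (1 / (T : ℝ)) := by
  have hT' : (1 : ℝ) ≤ T := by exact_mod_cast hT
  have hm' : (1 : ℝ) ≤ m := by exact_mod_cast hm
  have hK' : (1 : ℝ) ≤ K := by exact_mod_cast hK
  have hprod : 1 ≤ (K : ℝ) * m := one_le_mul_of_one_le_of_one_le hK' hm'
  have hQT : (T : ℝ) ≤ K * T * m / δ := by
    rw [le_div_iff₀ hδ]; nlinarith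
  have hQ1 : 1 ≤ (K : ℝ) * T * m / δ := hT'.trans hQT
  set Q := (K : ℝ) * T * m / δ with hQ
  have hlogQ : 0 ≤ Real.log Q := Real.log_nonneg hQ1
  have hl4 : Real.log (2 * T * m / (δ / (K + 1))) ≤ 2 * Real.log 2 + Real.log Q := by
    have e : 2 * Real.log 2 + Real.log Q = Real.log (4 * Q) := by
      rw [Real.log_mul (by norm_num) (by linarith), show (4 : ℝ) = 2 ^ 2 by norm_num, Real.log_pow]
      push_cast; ring
    rw [e]
    refine Real.log_le_log (by positivity) ?_
    rw [hQ, div_div_eq_mul_div, ← mul_div_assoc, div_le_div_iff_of_pos_right hδ]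
    have : (0 : ℝ) ≤ T * m := by positivity
    nlinarith
  have hlog2 : Real.log 2 ≤ 1 := by linarith [Real.log_two_lt_d9]
  -- For T = 1 the logarithm of Q can vanish and the 1/T term must absorb 2 log 2; for T ≥ 2 it is
  -- at least log 2.
  rcases hT.eq_or_lt with rfl | hT2
  · simp only [Nat.cast_one, Real.sqrt_one, div_one] at *
    linarith
  · have h2 : Real.log 2 ≤ Real.log Q :=
      Real.log_le_log two_pos (le_trans (by exact_mod_cast hT2) hQT)
    have h3 : Real.log (2 * T * m / (δ / (K + 1))) / √(T : ℝ) ≤ 3 * Real.log Q / √(T : ℝ) := by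
      gcongr; linarith
    have h4 : 0 ≤ 1 / (T : ℝ) := by positivity
    rw [mul_div_assoc 3] at h3
    linarith

end

/-! ### Union bound over the grid and assembly of the two one-sided estimates -/

theorem mainTheorem4 :
    ∃ A : ℝ, 0 < A ∧
      ∀ (n m : ℕ) (C : Matrix (Fin n) (Fin n) ℝ) (V : Matrix (Fin m) (Fin m) ℝ)
        (Ψ : Matrix (Fin m) (Fin n) ℝ) (β : ℝ≥0∞) (N δ : ℝ) (K T : ℕ),
        C.IsSymm → V.PosSemidef → V ≠ 0 → Ψᵀ * Ψ = 1 →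
        0 < β → 0 < N → N < n → 0 < δ → δ ≤ 1 → 1 ≤ K → 1 ≤ T →
        ∀ (Ω : Type*) [MeasurableSpace Ω] (P : Measure Ω) [IsProbabilityMeasure P]
          (z : Fin (K + 1) → ℕ → Ω → Fin n → ℝ),
          (∀ k, ∀ t < T, HasLaw (z k t) (Measure.pi fun _ : Fin n => gaussianReal 0 1) P) →
          (∀ k, iIndepFun (fun t : Fin T => z k t) P) →
          1 - δ ≤ P.real {ω |
            |maxDualEst C V Ψ β N K T δ (fun k t => z k t ω) - optValue C V Ψ β N| / n ≤
              A * (cHartree V Ψ * Real.log (K * T * m / δ) / √(T : ℝ)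
                + (1 / (T : ℝ) + 1 / (K : ℝ)) *
                  (specNorm C + cHartree V Ψ
                    + betaInv β * Real.log (1 / (N / n * (1 - N / n)))))} := by
  -- In the coefficient of B/T: 57 = 19 · 3 from the logarithm, 2 from the linear term of the
  -- regret, 1 from the near-minimizer.
  refine ⟨60, by norm_num, ?_⟩
  intro n m C V Ψ β N δ K T hCs hV hV0 hΨ _ hN hNn hδ hδ1 hK hT Ω _ P _ z hz hind
  have hC : C.IsHermitian := by
    rw [IsHermitian, conjTranspose_eq_transpose_of_trivial]; exact hCs
  have hn' : (0 : ℝ) < n := hN.trans hNn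
  have hn : 0 < n := by exact_mod_cast hn'
  have hT' : (0 : ℝ) < T := by exact_mod_cast hT
  have hK' : (0 : ℝ) < K := by exact_mod_cast hK
  have hm : 1 ≤ m := by
    by_contra! h
    obtain rfl : m = 0 := by omega
    exact hV0 (Subsingleton.elim _ _)
  have hm' : (1 : ℝ) ≤ m := by exact_mod_cast hm
  have hc := cHartree_pos hΨ hn hV0
  -- One deterministic comparison point serves all K + 1 runs, as the moment bound requires; its
  -- suboptimality n c_h / T fits in the 1/T term.
  obtain ⟨X, hX, htr, hXlt⟩ := exists_freeEnergy_lt (C := C) (V := V) (Ψ := Ψ) (β := β) hN hNn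
    (div_pos (mul_pos hn' hc) hT')
  set L := Real.log (2 * T * m / (δ / (K + 1))) with hL
  set B := specNorm C + cHartree V Ψ + betaInv β * Real.log (1 / (N / n * (1 - N / n))) with hB
  have hBe : errorScale C V Ψ β N = B := rfl
  have hcB : cHartree V Ψ ≤ B := by
    have h := log_filling_nonneg hN hNn
    have h1 := mul_nonneg (betaInv_nonneg β) (add_nonneg h.1 h.2)
    rw [← log_filling_eq hN hNn] at h1
    have h2 := specNorm_nonneg (C := C)
    rw [hB]; linarith
  set bad : Fin (K + 1) → Set Ω := fun k => {ω | ¬ RunGood C V Ψ β (muGrid C V Ψ β N K k)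
    (mirrorStep V Ψ β T (δ / (K + 1))) T L X (fun t => z k t ω)} with hbad
  have hδK : 0 < δ / (K + 1) := by positivity
  have hδK1 : δ / (K + 1) ≤ 1 := by rw [div_le_one (by positivity)]; linarith
  have hbadle : P (⋃ k, bad k) ≤ ENNReal.ofReal δ := by
    refine (measure_iUnion_fintype_le _ _).trans ((Finset.sum_le_sum fun k _ =>
      measure_not_runGood_le hC hΨ hn hm hV0 β _ _ hT hδK hδK1 hX P (hz k) (hind k)).trans_eq ?_)
    rw [Finset.sum_const, Finset.card_univ, Fintype.card_fin, nsmul_eq_mul,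
      ← ENNReal.ofReal_natCast, ← ENNReal.ofReal_mul (by positivity)]
    congr 1
    push_cast
    field_simp
  have hgood : ∀ ω, ω ∉ ⋃ k, bad k →
      |maxDualEst C V Ψ β N K T δ (fun k t => z k t ω) - optValue C V Ψ β N| / n ≤
        60 * (cHartree V Ψ * Real.log (K * T * m / δ) / √(T : ℝ)
          + (1 / (T : ℝ) + 1 / (K : ℝ)) * B) := by
    intro ω hω
    have hω' : ∀ k, RunGood C V Ψ β (muGrid C V Ψ β N K k)
        (mirrorStep V Ψ β T (δ / (K + 1))) T L X (fun t => z k t ω) := fun k => by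
      by_contra h
      exact hω (Set.mem_iUnion.2 ⟨k, h⟩)
    have hlow := optValue_sub_le_maxDualEst (β := β) hC hV hΨ hV0 hN hNn hK hT δ
      (fun k t => z k t ω)
    have hup : maxDualEst C V Ψ β N K T δ (fun k t => z k t ω) ≤ freeEnergy C V Ψ β X +
        n * (19 * (cHartree V Ψ * L / √(T : ℝ)) + 2 * B / T) :=
      ciSup_le fun k => by
        have := dualEst_sub_le hC hV hΨ hV0 hm hN hNn hK hT hδ hδ1 k hX htr (hω' k)
        rw [hBe, ← hL] at this
        change dualEst C V Ψ β N K T δ k (fun t => z k t ω) ≤ _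
        linarith
    have hlog := mul_le_mul_of_nonneg_left (log_confidence_le hK hT hm hδ hδ1) hc.le
    rw [← hL] at hlog
    set Q := cHartree V Ψ * Real.log (K * T * m / δ) / √(T : ℝ) with hQ
    have hQ0 : 0 ≤ Q := by
      refine div_nonneg (mul_nonneg hc.le (Real.log_nonneg ?_)) (Real.sqrt_nonneg _)
      have h1 : (1 : ℝ) ≤ K * T := by exact_mod_cast Nat.mul_le_mul hK hT
      rw [le_div_iff₀ hδ]
      nlinarith [one_le_mul_of_one_le_of_one_le h1 hm']
    have hlog' : cHartree V Ψ * L / √(T : ℝ) ≤ 3 * Q + 3 * (B / T) := by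
      have h1 : cHartree V Ψ / T ≤ B / T := by gcongr
      have e : cHartree V Ψ * (3 * (Real.log (K * T * m / δ) / √(T : ℝ)) + 3 * (1 / (T : ℝ)))
        = 3 * Q + 3 * (cHartree V Ψ / T) := by rw [hQ]; ring
      rw [e, ← mul_div_assoc] at hlog
      linarith
    have hBT : 0 ≤ B / T := div_nonneg (hc.le.trans hcB) hT'.le
    have hBK : 0 ≤ B / K := div_nonneg (hc.le.trans hcB) hK'.le
    have hcT : cHartree V Ψ / T ≤ B / T := by gcongr
    have e60 : 60 * (Q + (1 / (T : ℝ) + 1 / (K : ℝ)) * B) = 60 * Q + 60 * (B / T) + 60 * (B / K) := by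
      ring
    rw [div_le_iff₀ hn', e60, abs_le]
    rw [hBe, mul_div_assoc] at hlow
    rw [mul_div_assoc 2 B] at hup
    rw [mul_div_assoc] at hXlt
    constructor
    · have : n * (2 * (B / K)) ≤ n * (60 * Q + 60 * (B / T) + 60 * (B / K)) :=
        mul_le_mul_of_nonneg_left (by linarith) hn'.le
      linarith
    · have : n * (19 * (cHartree V Ψ * L / √(T : ℝ)) + 2 * (B / T)) + n * (cHartree V Ψ / T)
          ≤ n * (60 * Q + 60 * (B / T) + 60 * (B / K)) := by
        rw [← mul_add]
        exact mul_le_mul_of_nonneg_left (by linarith) hn'.le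
      linarith
  set S : Set Ω := {ω | |maxDualEst C V Ψ β N K T δ (fun k t => z k t ω) - optValue C V Ψ β N| / n ≤
        60 * (cHartree V Ψ * Real.log (K * T * m / δ) / √(T : ℝ)
          + (1 / (T : ℝ) + 1 / (K : ℝ)) * B)} with hS
  -- Covering and subadditivity give the lower bound for S without measurability of S or of the bad
  -- sets.
  have hcover : (Set.univ : Set Ω) ⊆ S ∪ ⋃ k, bad k := fun ω _ => by
    by_cases h : ω ∈ ⋃ k, bad k
    · exact Or.inr h
    · exact Or.inl (hgood ω h)
  have h1 : (1 : ℝ) ≤ P.real S + P.real (⋃ k, bad k) := by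
    have := (measureReal_mono (μ := P) hcover).trans (measureReal_union_le _ _)
    rwa [probReal_univ] at this
  have h2 : P.real (⋃ k, bad k) ≤ δ := ENNReal.toReal_le_of_le_ofReal hδ.le hbadle
  linarith
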